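/- Let $1\le M\le N$ and $L\ge 1$ be integers, let $\mathbf R\in\mathbb C^{M\times M}$ be positive definite with eigendecomposition $\mathbf R=\mathbf U\,\mathrm{diag}(\lambda_1,\dots,\lambda_M)\,\mathbf U^{\mathsf H}$, $\mathbf U=[\mathbf u_1,\dots,\mathbf u_M]$ unitary. For a power budget $p>0$ let $s_m^\star(p)=\max\{0,\frac1\nu-\frac1{L\lambda_m}\}$, where $\nu>0$ is determined by $\sum_{m=1}^M s_m^\star(p)=p$, and let $\mathbf P_{\rm s}=\mathbf U\,\mathrm{diag}(s_1^\star(p),\dots,s_M^\star(p))^{1/2}$ (the sensing-centric (S-C) precoder). For $m=1,\dots,M$ let $\alpha_m,\alpha_{m'}>0$ with $\alpha_m+\alpha_{m'}=1$ (power coefficients) and $\eta_m,\eta_{m'}>0$ (path losses). On a probability space let $\mathbf H_m,\mathbf H_{m'}$ be random $N\times M$ matrices, each with i.i.d. $\mathcal{CN}(0,1)$ entries (no assumption is made on their joint law), and let $\mathbf v_m,\mathbf v_{m'}$ be random vectors in $\mathbb C^N$ that do not depend on $p$ and satisfy $\mathbf H_m^{\mathsf H}\mathbf v_m=\mathbf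 u_m$ and $\mathbf H_{m'}^{\mathsf H}\mathbf v_{m'}=\mathbf u_m$ almost surely. The sum ergodic communication rate (ECR) of the S-C design is $$\mathcal R(p)=\sum_{m=1}^M\left(\mathbb E\log_2\Big(1+\frac{\alpha_m\eta_m^{-1}s_m^\star(p)}{\|\mathbf v_m\|^2}\Big)+\mathbb E\log_2\Big(1+\frac{\alpha_{m'}\eta_{m'}^{-1}s_m^\star(p)}{\alpha_m\eta_{m'}^{-1}s_m^\star(p)+\|\mathbf v_{m'}\|^2}\Big)\right).$$ Let $\lambda_{\max}$ be the largest eigenvalue of the complex Wishart matrix $\mathbf H\mathbf H^{\mathsf H}$, where $\mathbf H$ is $N\times M$ with i.i.d. $\mathcal{CN}(0,1)$ entries, and put $$\tilde{\mathcal R}(p)=\sum_{m=1}^M\left(\mathbb E\log_2\big(1+\alpha_m\eta_m^{-1}s_m^\star(p)\lambda_{\max}\big)+\mathbb E\log_2\Big(1+\frac{\alpha_{m'}\eta_{m'}^{-1}s_m^\star(p)\lambda_{\max}}{\alpha_m\eta_{m'}^{-1}s_m^\star(p)\lambda_{\max}+1}\Big)\right).$$ Then the following hold. 1. For every $p>0$,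 $\mathbf P_{\rm s}$ maximizes the sensing rate $\frac ML\log_2\det(\mathbf I_M+L\mathbf P^{\mathsf H}\mathbf R\mathbf P)$ over all $\mathbf P\in\mathbb C^{M\times M}$ with $\mathrm{tr}(\mathbf P\mathbf P^{\mathsf H})\le p$. 2. The random variable $\log_2\lambda_{\max}$ and, for every $p>0$, all random variables in the expectations above are integrable, and $\mathcal R(p)\le\tilde{\mathcal R}(p)$ for every $p>0$. 3. As $p\to\infty$, $$\tilde{\mathcal R}(p)=M\big(\log_2p-\log_2M+\mathbb E[\log_2\lambda_{\max}]\big)+\sum_{m=1}^M\log_2\eta_m^{-1}+o(1),$$ and hence $\lim_{p\to\infty}\tilde{\mathcal R}(p)/\log_2p=M$. 4. If $N=M$, then as $p\to\infty$, $$\mathcal R(p)=M\Big(\log_2p-\log_2M-\frac{\mathcal C}{\ln2}\Big)+\sum_{m=1}^M\log_2\eta_m^{-1}+o(1),$$ where $\mathcal C$ is the Euler constant, and hence the high-SNR slope $\lim_{p\to\infty}\mathcal R(p)/\log_2p$ equals $M$. -/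

import Mathlib

open MeasureTheory ProbabilityTheory Filter Topology Matrix
open scoped ComplexOrder

namespace NomaIsac

noncomputable section

/-- The circularly symmetric complex Gaussian law `CN(0,1)`: independent real and imaginary
parts, each centred Gaussian with variance `1/2`. -/
def stdComplexGaussian : Measure ℂ :=
  ((gaussianReal 0 (1 / 2)).prod (gaussianReal 0 (1 / 2))).map
    Complex.measurableEquivRealProd.symm

/-- The law of an `N × M` Rayleigh fading channel matrix: i.i.d. `CN(0,1)` entries
(a matrix is written as the array of its entries here, which carries the product σ-algebra). -/
def rayleighLaw (N M : ℕ) : Measure (Fin N → Fin M → ℂ) :=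
  Measure.pi fun _ : Fin N => Measure.pi fun _ : Fin M => stdComplexGaussian

/-- The largest eigenvalue of the (complex Wishart) matrix `H Hᴴ`. -/
def largestEigenvalue {N M : ℕ} (H : Matrix (Fin N) (Fin M) ℂ) : ℝ :=
  ⨆ i : Fin N, (Matrix.isHermitian_mul_conjTranspose_self H).eigenvalues i

/-- The law of the largest eigenvalue of the complex Wishart matrix `H Hᴴ`, where `H` is an
`N × M` matrix with i.i.d. `CN(0,1)` entries. -/
def largestEigenvalueLaw (N M : ℕ) : Measure ℝ :=
  (rayleighLaw N M).map fun h => largestEigenvalue (Matrix.of h)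

/-- The downlink sensing rate `(M / L) log₂ det (I + L Pᴴ R P)` of the precoder `P`
(the determinant is a positive real number when `R` is positive semidefinite). -/
def sensingRate {M : ℕ} (L : ℕ) (R P : Matrix (Fin M) (Fin M) ℂ) : ℝ :=
  (M : ℝ) / (L : ℝ) * Real.logb 2 (1 + (L : ℂ) • (Pᴴ * R * P)).det.re

/-- `P` is a sensing-centric precoder for the power budget `p`: it satisfies
`tr (P Pᴴ) ≤ p` and maximizes the sensing rate among all such precoders. -/
def IsSensingCentric {M : ℕ} (L : ℕ) (R : Matrix (Fin M) (Fin M) ℂ) (p : ℝ)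
    (P : Matrix (Fin M) (Fin M) ℂ) : Prop :=
  (P * Pᴴ).trace.re ≤ p ∧
    ∀ P' : Matrix (Fin M) (Fin M) ℂ, (P' * P'ᴴ).trace.re ≤ p →
      sensingRate L R P' ≤ sensingRate L R P

/-- `s` is the water-filling power allocation with budget `p` over the eigenvalues `lam`:
`s m = max {0, 1 / ν - 1 / (L * lam m)}`, the water level being fixed by `∑ m, s m = p`. -/
def IsWaterFilling {M : ℕ} (L : ℕ) (lam : Fin M → ℝ) (p : ℝ) (s : Fin M → ℝ) : Prop :=
  ∃ ν : ℝ, 0 < ν ∧ (∀ m, s m = max 0 (1 / ν - 1 / ((L : ℝ) * lam m))) ∧ ∑ m, s m = p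

/-- The precoder `U diag(√s₁, …, √s_M)`. -/
def precoder {M : ℕ} (U : Matrix (Fin M) (Fin M) ℂ) (s : Fin M → ℝ) :
    Matrix (Fin M) (Fin M) ℂ :=
  U * Matrix.diagonal fun m => ((Real.sqrt (s m) : ℝ) : ℂ)

/-- The communication rate of a near user, as a function of `x = ‖v‖⁻²`, for the power
coefficient `a`, path loss `η` and pair power `s`. -/
def nearRate (a η s x : ℝ) : ℝ :=
  Real.logb 2 (1 + a * η⁻¹ * s * x)

/-- The communication rate of a far user with power coefficient `a'` and path loss `η'`, as a
function of `x = ‖v'‖⁻²`; the signal of the near user (coefficient `a`) is interference. -/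
def farRate (a a' η' s x : ℝ) : ℝ :=
  Real.logb 2 (1 + a' * η'⁻¹ * s * x / (a * η'⁻¹ * s * x + 1))

/-- The sum ergodic communication rate: the sum over the user pairs of the expected rates of the
near and the far user, with detection vectors `v m`, `v' m`. -/
def sumECR {Ω : Type*} [MeasurableSpace Ω] (μ : Measure Ω) {M N : ℕ} (a a' η η' : Fin M → ℝ)
    (s : Fin M → ℝ) (v v' : Fin M → Ω → EuclideanSpace ℂ (Fin N)) : ℝ :=
  ∑ m, ((∫ ω, nearRate (a m) (η m) (s m) (‖v m ω‖ ^ 2)⁻¹ ∂μ) +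
    ∫ ω, farRate (a m) (a' m) (η' m) (s m) (‖v' m ω‖ ^ 2)⁻¹ ∂μ)

/-- The upper bound of the sum ergodic communication rate, in which each `‖v‖⁻²` is replaced by
the largest eigenvalue of the complex Wishart matrix. -/
def sumECRBound {M : ℕ} (N : ℕ) (a a' η η' : Fin M → ℝ) (s : Fin M → ℝ) : ℝ :=
  ∑ m, ((∫ x, nearRate (a m) (η m) (s m) x ∂(largestEigenvalueLaw N M)) +
    ∫ x, farRate (a m) (a' m) (η' m) (s m) x ∂(largestEigenvalueLaw N M))

end

end NomaIsac

namespace NomaIsac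

/-! A detection vector enters the rates only through its gain X = ‖v‖⁻². Since Hᴴv = u with ‖u‖ = 1,
one has 1 ≤ ‖H‖‖v‖, hence X ≤ ‖H‖² = λ_max pointwise (`inv_norm_sq_le_largestEigenvalue`). Both
rates increase with the gain, so the upper bound follows pair by pair, using only the marginal law
of each channel.

For the asymptotics, every water-filling power stays within a bounded distance of p/M
(`IsWaterFilling.abs_sub_le`). Dominated convergence, for which integrability of log X suffices,
gives log₂(a η⁻¹/M) + E log₂ X as the limit of the near rate minus log₂ p. The far rate is
interference-limited and tends to log₂(1 + a'/a) = -log₂ a, because a + a' = 1. Thus the power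
coefficients and the far path losses cancel (`tendsto_integral_pair_sub_logb`).

If N = M, K = (HU)ᵀ is again Rayleigh and the conjugate of v is the m-th column of K⁻¹. By Cramer's
rule X = |det K|²/∑ⱼ|adj(K)ⱼₘ|². The cofactors do not involve row m, so, given the other rows, X is
the squared modulus of a normalized linear form in Gaussians, that is of a CN(0,1) variable
(`map_invColNormSqInv`). The moment generating function of log|z|² is Γ(1 + t), whose derivative at
0 is -γ.

Optimality of water filling is a tangent-line argument: x ≤ exp(x - 1) on eigenvalues bounds a
determinant by a trace. After rescaling to be tight at the candidate, the exponent is nonpositive by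
the KKT conditions. -/

instance : IsProbabilityMeasure stdComplexGaussian :=
  Measure.isProbabilityMeasure_map (by fun_prop)

instance (N M : ℕ) : IsProbabilityMeasure (rayleighLaw N M) := by
  unfold rayleighLaw; infer_instance

/-! ### Complex Gaussian arrays: characteristic functions and invariances. -/

/-- The characteristic function of `CN(0,1)`. -/
lemma integral_exp_re_mul_stdComplexGaussian (c : ℂ) :
    ∫ z, Complex.exp (((c * z).re : ℝ) * Complex.I) ∂stdComplexGaussian =
      Complex.exp (-((‖c‖ ^ 2 / 4 : ℝ) : ℂ)) := by
  have key (t : ℝ) : ∫ x, Complex.exp (t * x * Complex.I) ∂gaussianReal 0 (1 / 2) =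
      Complex.exp (-((t ^ 2 / 4 : ℝ) : ℂ)) := by
    rw [← charFun_apply_real, charFun_gaussianReal]
    congr 1
    push_cast
    ring
  rw [stdComplexGaussian, integral_map_equiv]
  have : ∀ x : ℝ × ℝ, Complex.exp
      (((c * Complex.measurableEquivRealProd.symm x).re : ℝ) * Complex.I) =
      Complex.exp (c.re * x.1 * Complex.I) * Complex.exp ((-c.im : ℝ) * x.2 * Complex.I) := by
    intro x
    rw [← Complex.exp_add]
    congr 1
    simp [Complex.measurableEquivRealProd_symm_apply]
    ring
  simp_rw [this]
  rw [integral_prod_mul (fun x : ℝ => Complex.exp (c.re * x * Complex.I))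
    (fun y : ℝ => Complex.exp ((-c.im : ℝ) * y * Complex.I)), key, key, ← Complex.exp_add,
    Complex.sq_norm, Complex.normSq_apply]
  congr 1
  push_cast
  ring

lemma integral_exp_re_sum_pi {ι α : Type*} [Fintype ι] [MeasurableSpace α] (μ : Measure α)
    [SigmaFinite μ] (f : ι → α → ℝ) :
    ∫ y, Complex.exp ((∑ i, f i (y i) : ℝ) * Complex.I) ∂(Measure.pi fun _ : ι => μ) =
      ∏ i, ∫ z, Complex.exp (f i z * Complex.I) ∂μ := by
  rw [← integral_fintype_prod_eq_prod]
  congr 1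
  ext y
  rw [← Complex.exp_sum]
  congr 1
  push_cast
  rw [Finset.sum_mul]

/-- The characteristic function of a vector of independent `CN(0,1)` entries. -/
lemma integral_exp_re_sum_mul {ι : Type*} [Fintype ι] (c : ι → ℂ) :
    ∫ y, Complex.exp (((∑ i, c i * y i).re : ℝ) * Complex.I)
      ∂(Measure.pi fun _ : ι => stdComplexGaussian) =
      Complex.exp (-((∑ i, ‖c i‖ ^ 2 / 4 : ℝ) : ℂ)) := by
  simp_rw [Complex.re_sum]
  rw [integral_exp_re_sum_pi stdComplexGaussian (fun i z => (c i * z).re)]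
  simp_rw [integral_exp_re_mul_stdComplexGaussian]
  rw [← Complex.exp_sum]
  congr 1
  push_cast
  rw [Finset.sum_neg_distrib]

/-- The characteristic function of the Rayleigh law. -/
lemma integral_exp_re_rayleighLaw {N M : ℕ} (c : Fin N → Fin M → ℂ) :
    ∫ h, Complex.exp (((∑ i, ∑ j, c i j * h i j).re : ℝ) * Complex.I) ∂(rayleighLaw N M) =
      Complex.exp (-((∑ i, ∑ j, ‖c i j‖ ^ 2 / 4 : ℝ) : ℂ)) := by
  rw [rayleighLaw]
  simp_rw [Complex.re_sum (s := Finset.univ) (f := fun i => ∑ j, c i j * _)]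
  rw [integral_exp_re_sum_pi (Measure.pi fun _ : Fin M => stdComplexGaussian)
    (fun i y => (∑ j, c i j * y j).re)]
  simp_rw [integral_exp_re_sum_mul]
  rw [← Complex.exp_sum]
  congr 1
  push_cast
  rw [Finset.sum_neg_distrib]

/-- Brings real-linear functionals into the form for which the characteristic functions above are
computed, so that `Measure.ext_of_charFunDual` applies. -/
lemma exists_re_mul_eq (L : ℂ →L[ℝ] ℝ) : ∃ c : ℂ, ∀ z, L z = (c * z).re := by
  refine ⟨(L 1 : ℂ) - Complex.I * L Complex.I, fun z => ?_⟩
  conv_lhs => rw [← Complex.re_add_im z]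
  have h : (z.re : ℂ) + z.im * Complex.I = z.re • (1 : ℂ) + z.im • Complex.I := by simp
  rw [h, map_add, map_smul, map_smul]
  simp
  ring

lemma exists_re_sum_eq {ι : Type*} [Fintype ι] (L : StrongDual ℝ (ι → ℂ)) :
    ∃ c : ι → ℂ, ∀ y, L y = (∑ i, c i * y i).re := by
  classical
  choose c hc using fun i : ι =>
    exists_re_mul_eq (L.comp (ContinuousLinearMap.single ℝ (fun _ : ι => ℂ) i))
  refine ⟨c, fun y => ?_⟩
  have h : y = ∑ i, Pi.single i (y i) := (Finset.univ_sum_single y).symm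
  conv_lhs => rw [h]
  rw [map_sum, Complex.re_sum]
  exact Finset.sum_congr rfl fun i _ => hc i (y i)

lemma exists_re_sum_sum_eq {ι κ : Type*} [Fintype ι] [Fintype κ] (L : StrongDual ℝ (ι → κ → ℂ)) :
    ∃ c : ι → κ → ℂ, ∀ y, L y = (∑ i, ∑ j, c i j * y i j).re := by
  classical
  choose c hc using fun i : ι =>
    exists_re_sum_eq (L.comp (ContinuousLinearMap.single ℝ (fun _ : ι => κ → ℂ) i))
  refine ⟨c, fun y => ?_⟩
  have h : y = ∑ i, Pi.single i (y i) := (Finset.univ_sum_single y).symm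
  conv_lhs => rw [h]
  rw [map_sum, Complex.re_sum]
  exact Finset.sum_congr rfl fun i _ => hc i (y i)

lemma sum_norm_sq_mulVec {M : ℕ} {U : Matrix (Fin M) (Fin M) ℂ}
    (hU : U ∈ Matrix.unitaryGroup (Fin M) ℂ) (c : Fin M → ℂ) :
    ∑ k, ‖(U *ᵥ c) k‖ ^ 2 = ∑ k, ‖c k‖ ^ 2 := by
  have h (d : Fin M → ℂ) : ((∑ k, ‖d k‖ ^ 2 : ℝ) : ℂ) = star d ⬝ᵥ d := by
    simp [dotProduct, Complex.conj_mul']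
  apply Complex.ofReal_injective
  rw [h, h, star_mulVec, dotProduct_mulVec, vecMul_vecMul, ← star_eq_conjTranspose,
    Matrix.mem_unitaryGroup_iff'.1 hU, vecMul_one]

/-- Unitary invariance of the law of a vector of independent `CN(0,1)` entries. -/
lemma measurePreserving_vecMul_unitary {M : ℕ} {U : Matrix (Fin M) (Fin M) ℂ}
    (hU : U ∈ Matrix.unitaryGroup (Fin M) ℂ) :
    MeasurePreserving (fun y : Fin M → ℂ => y ᵥ* U)
      (Measure.pi fun _ : Fin M => stdComplexGaussian)
      (Measure.pi fun _ : Fin M => stdComplexGaussian) := by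
  have hm : Measurable (fun y : Fin M → ℂ => y ᵥ* U) :=
    (Continuous.matrix_vecMul continuous_id continuous_const).measurable
  refine ⟨hm, ?_⟩
  have : IsProbabilityMeasure ((Measure.pi fun _ : Fin M => stdComplexGaussian).map
    (fun y : Fin M → ℂ => y ᵥ* U)) := Measure.isProbabilityMeasure_map hm.aemeasurable
  refine Measure.ext_of_charFunDual (funext fun L => ?_)
  obtain ⟨c, hc⟩ := exists_re_sum_eq L
  rw [charFunDual_apply, charFunDual_apply, integral_map hm.aemeasurable (by fun_prop)]
  simp_rw [hc]
  -- Moving U onto the coefficients suffices: the characteristic function sees only their Euclidean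
  -- norm, which U preserves.
  have h (y : Fin M → ℂ) : ∑ i, c i * (y ᵥ* U) i = ∑ i, (U *ᵥ c) i * y i := by
    have := dotProduct_mulVec y U c
    rw [dotProduct_comm, dotProduct_comm _ c] at this
    exact this.symm
  simp_rw [h]
  rw [integral_exp_re_sum_mul, integral_exp_re_sum_mul]
  simp_rw [← Finset.sum_div]
  rw [sum_norm_sq_mulVec hU]

/-- A normalized linear form in independent `CN(0,1)` variables has law `CN(0,1)`. -/
lemma measurePreserving_sum_mul {ι : Type*} [Fintype ι] (c : ι → ℂ) (hc : ∑ i, ‖c i‖ ^ 2 = 1) :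
    MeasurePreserving (fun y : ι → ℂ => ∑ i, c i * y i)
      (Measure.pi fun _ : ι => stdComplexGaussian) stdComplexGaussian := by
  have hm : Measurable (fun y : ι → ℂ => ∑ i, c i * y i) := by fun_prop
  refine ⟨hm, ?_⟩
  have : IsProbabilityMeasure ((Measure.pi fun _ : ι => stdComplexGaussian).map
    (fun y : ι → ℂ => ∑ i, c i * y i)) := Measure.isProbabilityMeasure_map hm.aemeasurable
  refine Measure.ext_of_charFunDual (funext fun L => ?_)
  rw [charFunDual_apply, charFunDual_apply, integral_map hm.aemeasurable (by fun_prop)]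
  obtain ⟨t, ht⟩ := exists_re_mul_eq L
  simp_rw [ht, Finset.mul_sum, ← mul_assoc]
  rw [integral_exp_re_sum_mul, integral_exp_re_mul_stdComplexGaussian]
  simp_rw [norm_mul, mul_pow]
  rw [← Finset.sum_div, ← Finset.mul_sum, hc, mul_one]

/-- The characteristic function depends only on the sum of all squared moduli of the coefficients,
which is symmetric in the two indices. -/
lemma measurePreserving_transpose_rayleighLaw (N M : ℕ) :
    MeasurePreserving (fun (h : Fin N → Fin M → ℂ) j i => h i j)
      (rayleighLaw N M) (rayleighLaw M N) := by
  have hm : Measurable (fun (h : Fin N → Fin M → ℂ) (j : Fin M) (i : Fin N) => h i j) := by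
    fun_prop
  refine ⟨hm, ?_⟩
  have : IsProbabilityMeasure ((rayleighLaw N M).map
    (fun (h : Fin N → Fin M → ℂ) (j : Fin M) (i : Fin N) => h i j)) :=
      Measure.isProbabilityMeasure_map hm.aemeasurable
  refine Measure.ext_of_charFunDual (funext fun L => ?_)
  obtain ⟨c, hc⟩ := exists_re_sum_sum_eq L
  rw [charFunDual_apply, charFunDual_apply, integral_map hm.aemeasurable (by fun_prop)]
  simp_rw [hc]
  rw [integral_exp_re_rayleighLaw]
  have h (y : Fin N → Fin M → ℂ) : ∑ j, ∑ i, c j i * y i j = ∑ i, ∑ j, c j i * y i j :=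
    Finset.sum_comm
  simp_rw [h]
  rw [integral_exp_re_rayleighLaw (fun i j => c j i), Finset.sum_comm]

/-- Rayleigh fading is invariant under multiplication by a unitary matrix and transposition. -/
lemma measurePreserving_mul_unitary_transpose {N M : ℕ} {U : Matrix (Fin M) (Fin M) ℂ}
    (hU : U ∈ Matrix.unitaryGroup (Fin M) ℂ) :
    MeasurePreserving (fun (h : Fin N → Fin M → ℂ) (j : Fin M) (i : Fin N) => (h i ᵥ* U) j)
      (rayleighLaw N M) (rayleighLaw M N) :=
  (measurePreserving_transpose_rayleighLaw N M).comp
    (measurePreserving_pi _ _ fun _ => measurePreserving_vecMul_unitary hU)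

/-- Resampling one coordinate preserves a product of probability measures. -/
lemma measurePreserving_update {ι : Type*} [Fintype ι] [DecidableEq ι] {α : ι → Type*}
    [∀ i, MeasurableSpace (α i)] (μ : ∀ i, Measure (α i)) [∀ i, IsProbabilityMeasure (μ i)]
    (i : ι) :
    MeasurePreserving (fun q : (∀ i, α i) × α i => Function.update q.1 i q.2)
      ((Measure.pi μ).prod (μ i)) (Measure.pi μ) := by
  have hm : Measurable (fun q : (∀ i, α i) × α i => Function.update q.1 i q.2) :=
    measurable_update'
  refine ⟨hm, (Measure.pi_eq fun s hs => ?_).symm⟩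
  rw [Measure.map_apply hm (MeasurableSet.univ_pi hs)]
  have : (fun q : (∀ i, α i) × α i => Function.update q.1 i q.2) ⁻¹' Set.univ.pi s =
      (Set.univ.pi (Function.update s i Set.univ)) ×ˢ s i := by
    ext q
    simp only [Set.mem_preimage, Set.mem_pi, Set.mem_univ, true_imp_iff, Set.mem_prod]
    constructor
    · intro h
      refine ⟨fun j => ?_, by simpa using h i⟩
      by_cases hj : j = i
      · subst hj; simp
      · simpa [hj] using h j
    · rintro ⟨h1, h2⟩ j
      by_cases hj : j = i
      · subst hj; simpa using h2
      · simpa [hj] using h1 j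
  rw [this, Measure.prod_prod, Measure.pi_pi,
    ← Finset.mul_prod_erase Finset.univ (fun j => μ j (s j)) (Finset.mem_univ i),
    ← Finset.mul_prod_erase Finset.univ (fun j => μ j (Function.update s i Set.univ j))
      (Finset.mem_univ i), mul_comm (μ i (s i))]
  congr 1
  rw [Function.update_self, measure_univ, one_mul]
  refine Finset.prod_congr rfl fun j hj => ?_
  rw [Function.update_of_ne (Finset.ne_of_mem_erase hj)]

/-! ### The logarithm of |z|² for z ~ CN(0,1). -/

/-- The density of `CN(0,1)`. -/
lemma integral_stdComplexGaussian (f : ℂ → ℝ) :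
    ∫ z, f z ∂stdComplexGaussian =
      Real.pi⁻¹ * ∫ z : ℂ, f z * Real.exp (-‖z‖ ^ 2) := by
  have h2 : (1 / 2 : NNReal) ≠ 0 := by norm_num
  rw [stdComplexGaussian, integral_map_equiv, gaussianReal_of_var_ne_zero 0 h2,
    prod_withDensity (measurable_gaussianPDF 0 _) (measurable_gaussianPDF 0 _),
    ← Measure.volume_eq_prod, integral_withDensity_eq_integral_toReal_smul (by fun_prop)
      (by simp [gaussianPDF, ENNReal.mul_lt_top]), ← integral_const_mul,
    ← Complex.volume_preserving_equiv_real_prod.symm.integral_comp'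
      (g := fun z : ℂ => Real.pi⁻¹ * (f z * Real.exp (-‖z‖ ^ 2)))]
  congr 1
  ext x
  have hp : (gaussianPDF 0 (1 / 2) x.1 * gaussianPDF 0 (1 / 2) x.2).toReal =
      Real.pi⁻¹ * Real.exp (-(x.1 ^ 2 + x.2 ^ 2)) := by
    rw [ENNReal.toReal_mul, toReal_gaussianPDF, toReal_gaussianPDF, gaussianPDFReal,
      gaussianPDFReal]
    rw [mul_mul_mul_comm, ← mul_inv, Real.mul_self_sqrt (by positivity), ← Real.exp_add]
    push_cast
    congr 2 <;> ring
  rw [hp, Complex.sq_norm, Complex.normSq_apply]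
  simp [Complex.measurableEquivRealProd_symm_apply]
  ring_nf

lemma stdComplexGaussian_singleton_zero : stdComplexGaussian {0} = 0 := by
  have : NullSingletonClass (gaussianReal 0 (1 / 2)) :=
    nullSingletonClass_gaussianReal (by norm_num)
  rw [stdComplexGaussian, MeasurableEquiv.map_apply]
  have : Complex.measurableEquivRealProd.symm ⁻¹' {0} = {((0 : ℝ), (0 : ℝ))} := by
    ext x
    simp [Complex.ext_iff, Prod.ext_iff]
  rw [this, ← Set.singleton_prod_singleton, Measure.prod_prod, measure_singleton, zero_mul]

lemma ae_ne_zero_stdComplexGaussian : ∀ᵐ z ∂stdComplexGaussian, z ≠ 0 := by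
  rw [ae_iff]
  simpa using stdComplexGaussian_singleton_zero

lemma integral_exp_mul_log_norm_sq {t : ℝ} (ht : -1 < t) :
    ∫ z, Real.exp (t * Real.log (‖z‖ ^ 2)) ∂stdComplexGaussian = Real.Gamma (t + 1) := by
  have h : ∀ᵐ z ∂stdComplexGaussian, Real.exp (t * Real.log (‖z‖ ^ 2)) = ‖z‖ ^ (2 * t) := by
    filter_upwards [ae_ne_zero_stdComplexGaussian] with z hz
    have hz : 0 < ‖z‖ := norm_pos_iff.2 hz
    rw [Real.rpow_def_of_pos hz, Real.log_pow]
    congr 1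
    push_cast
    ring
  rw [integral_congr_ae h, integral_stdComplexGaussian]
  have := Complex.integral_rpow_mul_exp_neg_rpow (p := 2) (q := 2 * t) (by norm_num) (by linarith)
  simp only [Real.rpow_two] at this
  rw [this, ← mul_assoc]
  have h1 : Real.pi⁻¹ * (2 * Real.pi / 2) = 1 := by field_simp
  rw [h1, one_mul]
  congr 1
  ring

/-- A non-integrable function has integral 0 by convention, whereas the value just computed is a
positive Gamma value. -/
lemma integrable_exp_mul_log_norm_sq {t : ℝ} (ht : -1 < t) :
    Integrable (fun z => Real.exp (t * Real.log (‖z‖ ^ 2))) stdComplexGaussian := by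
  by_contra h
  have := integral_exp_mul_log_norm_sq ht
  rw [integral_undef h] at this
  exact (Real.Gamma_pos_of_pos (by linarith : 0 < t + 1)).ne this

lemma zero_mem_interior_integrableExpSet_log_norm_sq :
    (0 : ℝ) ∈ interior (integrableExpSet (fun z : ℂ => Real.log (‖z‖ ^ 2)) stdComplexGaussian) :=
  mem_interior.2 ⟨Set.Ioi (-1), fun _ ht => integrable_exp_mul_log_norm_sq ht, isOpen_Ioi,
    by simp⟩

lemma integrable_log_norm_sq_stdComplexGaussian :
    Integrable (fun z : ℂ => Real.log (‖z‖ ^ 2)) stdComplexGaussian := by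
  simpa using integrable_pow_mul_exp_of_mem_interior_integrableExpSet
    zero_mem_interior_integrableExpSet_log_norm_sq 1

/-- The logarithm of the squared modulus of a `CN(0,1)` variable has mean `-γ`. -/
lemma integral_log_norm_sq_stdComplexGaussian :
    ∫ z, Real.log (‖z‖ ^ 2) ∂stdComplexGaussian = -Real.eulerMascheroniConstant := by
  have h := deriv_mgf_zero zero_mem_interior_integrableExpSet_log_norm_sq
  rw [← h, Real.eulerMascheroniConstant_eq_neg_deriv, neg_neg]
  have he : mgf (fun z : ℂ => Real.log (‖z‖ ^ 2)) stdComplexGaussian =ᶠ[𝓝 0]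
      fun t => Real.Gamma (t + 1) := by
    filter_upwards [isOpen_Ioi.mem_nhds (show (0 : ℝ) ∈ Set.Ioi (-1) by simp)] with t ht
    exact integral_exp_mul_log_norm_sq ht
  rw [he.deriv_eq, deriv_comp_add_const, zero_add]

lemma integrable_norm_sq_stdComplexGaussian :
    Integrable (fun z : ℂ => ‖z‖ ^ 2) stdComplexGaussian := by
  refine (integrable_exp_mul_log_norm_sq (t := 1) (by norm_num)).congr ?_
  filter_upwards [ae_ne_zero_stdComplexGaussian] with z hz
  have hz : 0 < ‖z‖ := norm_pos_iff.2 hz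
  rw [one_mul, Real.exp_log (by positivity)]

/-! ### Square Rayleigh matrices: invertibility and the law of the gain. -/

lemma ae_sum_mul_ne_zero {ι : Type*} [Fintype ι] {c : ι → ℂ} (hc : c ≠ 0) :
    ∀ᵐ y ∂(Measure.pi fun _ : ι => stdComplexGaussian), ∑ i, c i * y i ≠ 0 := by
  have hpos : 0 < ∑ i, ‖c i‖ ^ 2 := by
    obtain ⟨i, hi⟩ := Function.ne_iff.1 hc
    exact Finset.sum_pos' (fun _ _ => by positivity)
      ⟨i, Finset.mem_univ i, by have := norm_pos_iff.2 hi; positivity⟩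
  have hr : 0 < √(∑ i, ‖c i‖ ^ 2) := Real.sqrt_pos.2 hpos
  set r := √(∑ i, ‖c i‖ ^ 2)
  -- Divided by the norm of c, the form has law CN(0,1), which has no atom at 0.
  have hmp := measurePreserving_sum_mul (fun i => c i / (r : ℂ)) (by
    simp_rw [norm_div, div_pow, ← Finset.sum_div]
    rw [Complex.norm_real, Real.norm_eq_abs, sq_abs, Real.sq_sqrt hpos.le, div_self hpos.ne'])
  filter_upwards [hmp.quasiMeasurePreserving.ae ae_ne_zero_stdComplexGaussian] with y hy h
  apply hy
  simp_rw [div_mul_eq_mul_div, ← Finset.sum_div, h, zero_div]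

/-- Column m of the adjugate is unaffected by row m, so the determinant is a linear form in that row
with coefficients fixed by the others. -/
lemma det_updateRow_eq_sum {n R : Type*} [Fintype n] [DecidableEq n] [CommRing R]
    (A : Matrix n n R) (m : n) (y : n → R) :
    (A.updateRow m y).det = ∑ j, A.adjugate j m * y j := by
  rw [det_eq_sum_mul_adjugate_row _ m]
  refine Finset.sum_congr rfl fun j _ => ?_
  rw [updateRow_self, adjugate_apply, adjugate_apply, updateRow_idem, mul_comm]

lemma adjugate_col_ne_zero {n R : Type*} [Fintype n] [DecidableEq n] [CommRing R]
    {A : Matrix n n R} (hA : A.det ≠ 0) (m : n) : (fun j => A.adjugate j m) ≠ 0 := by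
  intro h
  apply hA
  rw [det_eq_sum_mul_adjugate_row _ m]
  exact Finset.sum_eq_zero fun j _ => by rw [show A.adjugate j m = 0 from congrFun h j, mul_zero]

lemma measurable_det {M : ℕ} {α : Type*} [MeasurableSpace α] {f : α → Matrix (Fin M) (Fin M) ℂ}
    (hf : ∀ i j, Measurable fun x => f x i j) : Measurable fun x => (f x).det := by
  simp_rw [det_apply]
  exact Finset.measurable_sum _ fun σ _ =>
    (Finset.measurable_prod _ fun i _ => hf _ _).const_smul _

/-- A square Rayleigh fading matrix is almost surely invertible. -/
lemma ae_det_ne_zero_rayleighLaw (M : ℕ) :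
    ∀ᵐ K ∂(rayleighLaw M M), (Matrix.of K).det ≠ 0 := by
  -- Rows of the identity are replaced by random rows one at a time. Each new row enters the
  -- determinant through a nonzero linear form, which vanishes with probability 0.
  have key (S : Finset (Fin M)) : ∀ᵐ K ∂(rayleighLaw M M),
      (Matrix.of fun i => if i ∈ S then K i else Pi.single i 1).det ≠ 0 := by
    induction S using Finset.induction_on with
    | empty =>
      refine Eventually.of_forall fun K => ?_
      have : (Matrix.of fun i => if i ∈ (∅ : Finset (Fin M)) then K i else Pi.single i 1) = 1 := by
        ext i j
        simp [Matrix.one_apply, Pi.single_apply, eq_comm]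
      rw [this]
      simp
    | insert m S hm ih =>
      have hmeas : MeasurableSet {K : Fin M → Fin M → ℂ |
          (Matrix.of fun i => if i ∈ insert m S then K i else Pi.single i 1).det ≠ 0} := by
        refine (measurable_det fun i j => ?_) (measurableSet_singleton 0).compl
        by_cases hi : i ∈ insert m S
        · simp only [Matrix.of_apply, hi, if_true]; fun_prop
        · simp only [Matrix.of_apply, hi, if_false]; fun_prop
      have hmp := measurePreserving_update
        (fun _ : Fin M => Measure.pi fun _ : Fin M => stdComplexGaussian) m
      rw [rayleighLaw, ← hmp.map_eq]
      rw [ae_map_iff hmp.measurable.aemeasurable hmeas]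
      refine (Measure.ae_prod_mem_iff_ae_ae_mem (hmp.measurable hmeas)).2 ?_
      filter_upwards [ih] with K hK
      filter_upwards [ae_sum_mul_ne_zero (adjugate_col_ne_zero hK m)] with y hy
      rw [← det_updateRow_eq_sum] at hy
      have hA : (Matrix.of fun i => if i ∈ insert m S then Function.update K m y i
          else Pi.single i 1) = (Matrix.of fun i =>
            if i ∈ S then K i else Pi.single i 1).updateRow m y := by
        ext i j
        by_cases hi : i = m
        · subst hi; simp
        · simp [hi, updateRow_ne]
      simpa only [Set.mem_preimage, Set.mem_ofPred_eq, hA] using hy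
  simpa using key Finset.univ

/-- The reciprocal of the squared norm of the `m`-th column of `K⁻¹`. -/
noncomputable def invColNormSqInv {M : ℕ} (m : Fin M) (K : Fin M → Fin M → ℂ) : ℝ :=
  ‖(Matrix.of K).det‖ ^ 2 / ∑ j, ‖(Matrix.of K).adjugate j m‖ ^ 2

lemma measurable_invColNormSqInv {M : ℕ} (m : Fin M) : Measurable (invColNormSqInv m) := by
  have h1 : Measurable fun K : Fin M → Fin M → ℂ => (Matrix.of K).det :=
    measurable_det fun i j => by simp only [Matrix.of_apply]; fun_prop
  have h2 (j : Fin M) : Measurable fun K : Fin M → Fin M → ℂ => (Matrix.of K).adjugate j m := by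
    simp_rw [adjugate_apply]
    refine measurable_det fun i k => ?_
    by_cases hi : i = m
    · subst hi; simp
    · simp only [updateRow_ne hi, Matrix.of_apply]; fun_prop
  unfold invColNormSqInv
  fun_prop

/-- For a square Rayleigh fading matrix `K`, the reciprocal of the squared norm of a column of
`K⁻¹` is distributed as the squared modulus of a `CN(0,1)` variable. -/
lemma map_invColNormSqInv {M : ℕ} (m : Fin M) :
    (rayleighLaw M M).map (invColNormSqInv m) = stdComplexGaussian.map fun z => ‖z‖ ^ 2 := by
  ext s hs
  have hF := measurable_invColNormSqInv m
  have hmp := measurePreserving_update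
    (fun _ : Fin M => Measure.pi fun _ : Fin M => stdComplexGaussian) m
  rw [Measure.map_apply hF hs, Measure.map_apply (by fun_prop) hs, rayleighLaw,
    ← hmp.measure_preimage (hF hs).nullMeasurableSet,
    Measure.prod_apply (hmp.measurable (hF hs))]
  -- With row m resampled and the others frozen, the conditional probability is almost surely the
  -- same constant, so integrating over K is trivial.
  have hconst : ∀ᵐ K ∂(rayleighLaw M M), (Measure.pi fun _ : Fin M => stdComplexGaussian)
      (Prod.mk K ⁻¹' ((fun q : (Fin M → Fin M → ℂ) × (Fin M → ℂ) =>
        Function.update q.1 m q.2) ⁻¹' (invColNormSqInv m ⁻¹' s))) =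
      stdComplexGaussian ((fun z => ‖z‖ ^ 2) ⁻¹' s) := by
    filter_upwards [ae_det_ne_zero_rayleighLaw M] with K hK
    set c : Fin M → ℂ := fun j => (Matrix.of K).adjugate j m with hc
    have hpos : 0 < ∑ i, ‖c i‖ ^ 2 := by
      obtain ⟨i, hi⟩ := Function.ne_iff.1 (adjugate_col_ne_zero hK m)
      exact Finset.sum_pos' (fun _ _ => by positivity)
        ⟨i, Finset.mem_univ i, by have := norm_pos_iff.2 hi; positivity⟩
    set r := √(∑ i, ‖c i‖ ^ 2) with hr
    have hr2 : r ^ 2 = ∑ i, ‖c i‖ ^ 2 := Real.sq_sqrt hpos.le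
    have hmp' := measurePreserving_sum_mul (fun i => c i / (r : ℂ)) (by
      simp_rw [norm_div, div_pow, ← Finset.sum_div]
      rw [Complex.norm_real, Real.norm_eq_abs, sq_abs, hr2, div_self hpos.ne'])
    have hms : MeasurableSet ((fun z : ℂ => ‖z‖ ^ 2) ⁻¹' s) :=
      (by fun_prop : Measurable fun z : ℂ => ‖z‖ ^ 2) hs
    rw [← hmp'.measure_preimage hms.nullMeasurableSet]
    congr 1
    ext y
    simp only [Set.mem_preimage]
    have hu : Matrix.of (Function.update K m y) = (Matrix.of K).updateRow m y := rfl
    have hF : invColNormSqInv m (Function.update K m y) = ‖∑ i, c i / (r : ℂ) * y i‖ ^ 2 := by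
      rw [invColNormSqInv, hu, det_updateRow_eq_sum]
      simp_rw [adjugate_apply ((Matrix.of K).updateRow m y), updateRow_idem, ← adjugate_apply,
        div_mul_eq_mul_div, ← Finset.sum_div, norm_div, div_pow]
      rw [Complex.norm_real, Real.norm_eq_abs, sq_abs, hr2]
    rw [hF]
  have hconst' := lintegral_congr_ae hconst
  rw [rayleighLaw] at hconst'
  rw [hconst', lintegral_const, measure_univ, mul_one]

lemma inv_norm_sq_eq_invColNormSqInv {M : ℕ} {U : Matrix (Fin M) (Fin M) ℂ}
    (hU : U ∈ Matrix.unitaryGroup (Fin M) ℂ) (m : Fin M) (h : Fin M → Fin M → ℂ)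
    (v : EuclideanSpace ℂ (Fin M)) (hv : (Matrix.of h)ᴴ *ᵥ v.ofLp = fun i => U i m)
    (hdet : (Matrix.of fun j i => (h i ᵥ* U) j).det ≠ 0) :
    (‖v‖ ^ 2)⁻¹ = invColNormSqInv m (fun j i => (h i ᵥ* U) j) := by
  set K : Matrix (Fin M) (Fin M) ℂ := Matrix.of fun j i => (h i ᵥ* U) j with hK
  have hKt : K = (Matrix.of h * U)ᵀ := rfl
  -- Conjugate Uᴴ Hᴴ v = Uᴴ uₘ = eₘ; the entrywise conjugate of (HU)ᴴ is K.
  have h1 : K *ᵥ star v.ofLp = Pi.single m 1 := by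
    have : K = (((Matrix.of h * U)ᴴ).map star) := by
      ext i j
      exact (star_star (K i j)).symm
    have h2 : (Matrix.of h * U)ᴴ *ᵥ v.ofLp = Pi.single m 1 := by
      rw [conjTranspose_mul, ← mulVec_mulVec, hv]
      have : (fun i => U i m) = U *ᵥ Pi.single m 1 := by
        rw [mulVec_single_one]; rfl
      rw [this, mulVec_mulVec, ← star_eq_conjTranspose, Matrix.mem_unitaryGroup_iff'.1 hU,
        one_mulVec]
    ext j
    have h3 := congrArg star (congrFun h2 j)
    rw [this]
    simp only [mulVec, dotProduct, Matrix.map_apply, Pi.star_apply, star_sum, star_mul'] at h3 ⊢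
    rw [h3]
    by_cases hj : j = m
    · subst hj; simp
    · simp [hj]
  have h2 (j : Fin M) : ‖K.adjugate j m‖ ^ 2 = ‖K.det‖ ^ 2 * ‖v j‖ ^ 2 := by
    have h3 := congrArg (fun w => (K.adjugate *ᵥ w) j) h1
    simp only [mulVec_mulVec, adjugate_mul, smul_mulVec, one_mulVec, mulVec_single_one] at h3
    have h4 : K.adjugate j m = K.det * star (v j) := h3.symm
    rw [h4, norm_mul, norm_star, mul_pow]
  rw [invColNormSqInv]
  change _ = ‖K.det‖ ^ 2 / ∑ j, ‖K.adjugate j m‖ ^ 2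
  simp_rw [h2, ← Finset.mul_sum]
  rw [← EuclideanSpace.norm_sq_eq]
  have : ‖K.det‖ ^ 2 ≠ 0 := by simpa using hdet
  rw [div_mul_cancel_left₀ this]

/-- The effective gain of a detection vector of a square channel is exponentially distributed. -/
lemma hasLaw_inv_norm_sq {Ω : Type*} [MeasurableSpace Ω] {μ : Measure Ω} {M : ℕ}
    {U : Matrix (Fin M) (Fin M) ℂ} (hU : U ∈ Matrix.unitaryGroup (Fin M) ℂ) (m : Fin M)
    {H : Ω → Fin M → Fin M → ℂ} (hH : HasLaw H (rayleighLaw M M) μ)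
    {v : Ω → EuclideanSpace ℂ (Fin M)}
    (hv : ∀ᵐ ω ∂μ, (Matrix.of (H ω))ᴴ *ᵥ (v ω).ofLp = fun i => U i m) :
    HasLaw (fun ω => (‖v ω‖ ^ 2)⁻¹) (stdComplexGaussian.map fun z => ‖z‖ ^ 2) μ := by
  have hK := (measurePreserving_mul_unitary_transpose (N := M) hU).fun_comp_hasLaw hH
  have hF : HasLaw (invColNormSqInv m) (stdComplexGaussian.map fun z => ‖z‖ ^ 2)
      (rayleighLaw M M) :=
    ⟨(measurable_invColNormSqInv m).aemeasurable, map_invColNormSqInv m⟩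
  refine (hF.fun_comp hK).congr ?_
  have hdet := (hK.ae_iff (p := fun K => (Matrix.of K).det ≠ 0) ?_).2
    (ae_det_ne_zero_rayleighLaw M)
  · filter_upwards [hv, hdet] with ω h1 h2
    exact inv_norm_sq_eq_invColNormSqInv hU m (H ω) (v ω) h1 h2
  · exact measurableSet_setOfPred.1 ((measurable_det fun i j => by
      simp only [Matrix.of_apply]; fun_prop) (measurableSet_singleton 0).compl)

/-- The logarithm of an exponentially distributed variable is integrable with mean `-γ`. -/
lemma integrable_log_and_integral_log_of_hasLaw {Ω : Type*} [MeasurableSpace Ω] {μ : Measure Ω}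
    {X : Ω → ℝ}
    (hX : HasLaw X (stdComplexGaussian.map fun z => ‖z‖ ^ 2) μ) :
    Integrable (fun ω => Real.log (X ω)) μ ∧
      ∫ ω, Real.log (X ω) ∂μ = -Real.eulerMascheroniConstant := by
  have hz : AEMeasurable (fun z : ℂ => ‖z‖ ^ 2) stdComplexGaussian := by fun_prop
  have hl : AEStronglyMeasurable Real.log (μ.map X) := Real.measurable_log.aestronglyMeasurable
  have hl' : AEStronglyMeasurable Real.log (stdComplexGaussian.map fun z => ‖z‖ ^ 2) :=
    Real.measurable_log.aestronglyMeasurable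
  constructor
  · refine (integrable_map_measure hl hX.aemeasurable).1 ?_
    rw [hX.map_eq]
    exact (integrable_map_measure hl' hz).2 integrable_log_norm_sq_stdComplexGaussian
  · rw [← integral_map hX.aemeasurable hl, hX.map_eq, integral_map hz hl',
      integral_log_norm_sq_stdComplexGaussian]

/-! ### The largest Wishart eigenvalue. -/

section LargestEigenvalue

open scoped Matrix.Norms.L2Operator

/-- The largest eigenvalue of `H Hᴴ` is the squared operator norm of `H`. -/
lemma largestEigenvalue_eq_norm_sq {N M : ℕ} (H : Matrix (Fin N) (Fin M) ℂ) :
    largestEigenvalue H = ‖H‖ ^ 2 := by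
  have hA := Matrix.isHermitian_mul_conjTranspose_self H
  have h0 (i : Fin N) : 0 ≤ hA.eigenvalues i := eigenvalues_self_mul_conjTranspose_nonneg H i
  have h1 : ‖H * Hᴴ‖ = ‖H‖ ^ 2 := by
    have := l2_opNorm_conjTranspose_mul_self Hᴴ
    rw [conjTranspose_conjTranspose, l2_opNorm_conjTranspose] at this
    rw [this, sq]
  have h2 : ‖H * Hᴴ‖ = ‖(RCLike.ofReal ∘ hA.eigenvalues : Fin N → ℂ)‖ := by
    conv_lhs => rw [hA.spectral_theorem]
    rw [Unitary.conjStarAlgAut_apply, ← Unitary.coe_star, CStarRing.norm_mul_coe_unitary,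
      CStarRing.norm_coe_unitary_mul, l2_opNorm_diagonal]
  rw [← h1, h2, largestEigenvalue]
  have hbdd : BddAbove (Set.range hA.eigenvalues) := Set.finite_range _ |>.bddAbove
  have hn (i : Fin N) : ‖(RCLike.ofReal ∘ hA.eigenvalues : Fin N → ℂ) i‖ = hA.eigenvalues i := by
    simp [abs_of_nonneg (h0 i)]
  apply le_antisymm
  -- The real-valued supremum lemmas cover N = 0, where the supremum is 0 by default, as is the
  -- norm.
  · refine Real.iSup_le (fun i => ?_) (norm_nonneg _)
    rw [← hn i]
    exact norm_le_pi_norm _ i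
  · refine (pi_norm_le_iff_of_nonneg (Real.iSup_nonneg h0)).2 fun i => ?_
    rw [hn i]
    exact le_ciSup hbdd i

lemma measurable_largestEigenvalue (N M : ℕ) :
    Measurable fun h : Fin N → Fin M → ℂ => largestEigenvalue (Matrix.of h) := by
  simp_rw [largestEigenvalue_eq_norm_sq]
  have : Continuous fun h : Fin N → Fin M → ℂ => ‖Matrix.of h‖ ^ 2 :=
    (continuous_norm.comp (continuous_id : Continuous fun h : Matrix (Fin N) (Fin M) ℂ => h)).pow 2
  exact this.measurable

/-- Apply H to a basis vector. A single entry bounds log λ_max from below by a variable already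
known to be integrable. -/
lemma norm_sq_entry_le_largestEigenvalue {N M : ℕ} (H : Matrix (Fin N) (Fin M) ℂ) (i : Fin N)
    (j : Fin M) : ‖H i j‖ ^ 2 ≤ largestEigenvalue H := by
  rw [largestEigenvalue_eq_norm_sq]
  have h := l2_opNorm_mulVec H (EuclideanSpace.single j 1)
  rw [PiLp.norm_single, norm_one, mul_one] at h
  have h2 := PiLp.norm_apply_le
    ((EuclideanSpace.equiv (Fin N) ℂ).symm (H *ᵥ (EuclideanSpace.single j (1 : ℂ)))) i
  have h3 : ((EuclideanSpace.equiv (Fin N) ℂ).symm (H *ᵥ (EuclideanSpace.single j (1 : ℂ)))) i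
      = H i j := by
    simp
  rw [h3] at h2
  gcongr
  exact h2.trans h

lemma largestEigenvalue_le_sum {N M : ℕ} (H : Matrix (Fin N) (Fin M) ℂ) :
    largestEigenvalue H ≤ ∑ i, ∑ j, ‖H i j‖ ^ 2 := by
  have hA := Matrix.isHermitian_mul_conjTranspose_self H
  have h0 (i : Fin N) : 0 ≤ hA.eigenvalues i := eigenvalues_self_mul_conjTranspose_nonneg H i
  have ht : ∑ i, hA.eigenvalues i = ∑ i, ∑ j, ‖H i j‖ ^ 2 := by
    have := hA.trace_eq_sum_eigenvalues
    apply Complex.ofReal_injective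
    push_cast
    refine this.symm.trans ?_
    simp [Matrix.trace, Matrix.mul_apply, Complex.mul_conj']
  refine Real.iSup_le (fun i => ?_) (by positivity)
  rw [← ht]
  exact Finset.single_le_sum (fun i _ => h0 i) (Finset.mem_univ i)

/-- From 1 = ‖u‖ ≤ ‖H‖‖v‖; this also excludes v = 0, where the inverse would take its default value
0. -/
lemma inv_norm_sq_le_largestEigenvalue {N M : ℕ} (H : Matrix (Fin N) (Fin M) ℂ)
    (v : EuclideanSpace ℂ (Fin N)) (u : Fin M → ℂ) (hu : ∑ i, ‖u i‖ ^ 2 = 1)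
    (hv : Hᴴ *ᵥ v.ofLp = u) : 0 < (‖v‖ ^ 2)⁻¹ ∧ (‖v‖ ^ 2)⁻¹ ≤ largestEigenvalue H := by
  rw [largestEigenvalue_eq_norm_sq]
  have h := l2_opNorm_mulVec Hᴴ v
  rw [hv, l2_opNorm_conjTranspose] at h
  have h1 : ‖(EuclideanSpace.equiv (Fin M) ℂ).symm u‖ = 1 := by
    rw [EuclideanSpace.norm_eq]
    change √(∑ i, ‖u i‖ ^ 2) = 1
    rw [hu, Real.sqrt_one]
  rw [h1] at h
  have hpos : 0 < ‖v‖ := by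
    rcases (norm_nonneg v).eq_or_lt with h2 | h2
    · rw [← h2, mul_zero] at h; linarith
    · exact h2
  refine ⟨by positivity, ?_⟩
  rw [inv_le_iff_one_le_mul₀ (by positivity), ← mul_pow]
  exact one_le_pow₀ h

end LargestEigenvalue

lemma measurePreserving_entry_rayleighLaw {N M : ℕ} (i : Fin N) (j : Fin M) :
    MeasurePreserving (fun h : Fin N → Fin M → ℂ => h i j) (rayleighLaw N M)
      stdComplexGaussian :=
  (measurePreserving_eval (fun _ : Fin M => stdComplexGaussian) j).comp
    (measurePreserving_eval
      (fun _ : Fin N => Measure.pi fun _ : Fin M => stdComplexGaussian) i)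

instance (N M : ℕ) : IsProbabilityMeasure (largestEigenvalueLaw N M) :=
  Measure.isProbabilityMeasure_map (measurable_largestEigenvalue N M).aemeasurable

lemma ae_pos_largestEigenvalueLaw {N M : ℕ} (hN : 0 < N) (hM : 0 < M) :
    ∀ᵐ x ∂(largestEigenvalueLaw N M), 0 < x := by
  rw [largestEigenvalueLaw, ae_map_iff (measurable_largestEigenvalue N M).aemeasurable
    measurableSet_Ioi]
  filter_upwards [(measurePreserving_entry_rayleighLaw (⟨0, hN⟩ : Fin N)
    (⟨0, hM⟩ : Fin M)).quasiMeasurePreserving.ae ae_ne_zero_stdComplexGaussian] with h hh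
  have := norm_pos_iff.2 hh
  exact (by positivity : 0 < ‖h ⟨0, hN⟩ ⟨0, hM⟩‖ ^ 2).trans_le
    (norm_sq_entry_le_largestEigenvalue (Matrix.of h) ⟨0, hN⟩ ⟨0, hM⟩)

/-- Sandwich: log|h₀₀|² ≤ log λ_max ≤ λ_max - 1 ≤ ∑|hᵢⱼ|², with both extremes integrable. -/
lemma integrable_log_largestEigenvalueLaw {N M : ℕ} (hN : 0 < N) (hM : 0 < M) :
    Integrable (fun x => Real.log x) (largestEigenvalueLaw N M) := by
  have hm := measurable_largestEigenvalue N M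
  rw [largestEigenvalueLaw,
    integrable_map_measure Real.measurable_log.aestronglyMeasurable hm.aemeasurable]
  have hmp (i : Fin N) (j : Fin M) := measurePreserving_entry_rayleighLaw i j
  have h1 : Integrable (fun h : Fin N → Fin M → ℂ => ∑ i, ∑ j, ‖h i j‖ ^ 2)
      (rayleighLaw N M) :=
    integrable_finsetSum _ fun i _ => integrable_finsetSum _ fun j _ =>
      (hmp i j).integrable_comp_of_integrable integrable_norm_sq_stdComplexGaussian
  have h2 : Integrable (fun h : Fin N → Fin M → ℂ => Real.log (‖h ⟨0, hN⟩ ⟨0, hM⟩‖ ^ 2))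
      (rayleighLaw N M) :=
    (hmp _ _).integrable_comp_of_integrable integrable_log_norm_sq_stdComplexGaussian
  refine (h2.abs.add h1).mono' (Real.measurable_log.comp hm).aestronglyMeasurable ?_
  filter_upwards [(hmp ⟨0, hN⟩ ⟨0, hM⟩).quasiMeasurePreserving.ae
    ae_ne_zero_stdComplexGaussian] with h hh
  have hp : 0 < ‖h ⟨0, hN⟩ ⟨0, hM⟩‖ ^ 2 := by have := norm_pos_iff.2 hh; positivity
  have hle := norm_sq_entry_le_largestEigenvalue (Matrix.of h) ⟨0, hN⟩ ⟨0, hM⟩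
  have hle' := largestEigenvalue_le_sum (Matrix.of h)
  simp only [Matrix.of_apply] at hle hle'
  have hlog := Real.log_le_log hp hle
  have hlog' := Real.log_le_sub_one_of_pos (hp.trans_le hle)
  simp only [Function.comp, Real.norm_eq_abs, Pi.add_apply]
  refine abs_le.2 ⟨?_, ?_⟩
  · have := neg_abs_le (Real.log (‖h ⟨0, hN⟩ ⟨0, hM⟩‖ ^ 2))
    have : 0 ≤ ∑ i, ∑ j, ‖h i j‖ ^ 2 := by positivity
    linarith
  · have := abs_nonneg (Real.log (‖h ⟨0, hN⟩ ⟨0, hM⟩‖ ^ 2))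
    linarith

/-! ### Rates -/

/-- From 1 + cx ≤ (1 + c) max(1, x). Separating c from x yields the dominating functions used below.
-/
lemma log_one_add_mul_le {c x : ℝ} (hc : 0 ≤ c) (hx : 0 < x) :
    Real.log (1 + c * x) ≤ Real.log (1 + c) + |Real.log x| := by
  have h1 : 1 + c * x ≤ (1 + c) * max 1 x := by
    have := le_max_left 1 x
    have := mul_le_mul_of_nonneg_left (le_max_right 1 x) hc
    linarith
  have h2 : 0 < max 1 x := lt_max_of_lt_left one_pos
  refine (Real.log_le_log (by positivity) h1).trans ?_
  rw [Real.log_mul (by positivity) h2.ne']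
  gcongr
  rcases max_choice 1 x with h | h
  · rw [h, Real.log_one]; positivity
  · rw [h]; exact le_abs_self _

lemma nearRate_nonneg {a η s x : ℝ} (ha : 0 ≤ a) (hη : 0 ≤ η) (hs : 0 ≤ s) (hx : 0 ≤ x) :
    0 ≤ nearRate a η s x :=
  Real.logb_nonneg one_lt_two (le_add_of_nonneg_right (by positivity))

lemma nearRate_mono {a η s x y : ℝ} (ha : 0 ≤ a) (hη : 0 ≤ η) (hs : 0 ≤ s) (hx : 0 ≤ x)
    (hxy : x ≤ y) : nearRate a η s x ≤ nearRate a η s y := by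
  unfold nearRate
  have : 0 ≤ a * η⁻¹ * s := by positivity
  refine Real.logb_le_logb_of_le one_lt_two (by positivity) (by gcongr)

lemma farRate_nonneg {a a' η s x : ℝ} (ha : 0 ≤ a) (ha' : 0 ≤ a') (hη : 0 ≤ η) (hs : 0 ≤ s)
    (hx : 0 ≤ x) : 0 ≤ farRate a a' η s x :=
  Real.logb_nonneg one_lt_two (le_add_of_nonneg_right (by positivity))

lemma farRate_mono {a a' η s x y : ℝ} (ha : 0 ≤ a) (ha' : 0 ≤ a') (hη : 0 ≤ η) (hs : 0 ≤ s)
    (hx : 0 ≤ x) (hxy : x ≤ y) : farRate a a' η s x ≤ farRate a a' η s y := by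
  unfold farRate
  have hy : 0 ≤ y := hx.trans hxy
  refine Real.logb_le_logb_of_le one_lt_two (by positivity) ?_
  gcongr 1 + ?_
  rw [div_le_div_iff₀ (by positivity) (by positivity)]
  have : a' * η⁻¹ * s * x ≤ a' * η⁻¹ * s * y := by gcongr
  nlinarith

/-- Signal and interference share the same gain, so their ratio never exceeds a'/a, whatever the
power. -/
lemma farRate_le {a a' η s x : ℝ} (ha : 0 < a) (ha' : 0 ≤ a') (hη : 0 ≤ η) (hs : 0 ≤ s)
    (hx : 0 ≤ x) : farRate a a' η s x ≤ Real.logb 2 (1 + a' / a) := by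
  unfold farRate
  refine Real.logb_le_logb_of_le one_lt_two (by positivity) ?_
  gcongr 1 + ?_
  rw [div_le_div_iff₀ (by positivity) (by positivity)]
  nlinarith

lemma measurable_nearRate (a η s : ℝ) : Measurable (nearRate a η s) := by
  unfold nearRate Real.logb
  fun_prop

lemma measurable_farRate (a a' η s : ℝ) : Measurable (farRate a a' η s) := by
  unfold farRate Real.logb
  fun_prop

section Asymptotics

variable {Ω : Type*} [MeasurableSpace Ω] {μ : Measure Ω} [IsProbabilityMeasure μ] {X : Ω → ℝ}

lemma integrable_nearRate {a η s : ℝ} (ha : 0 ≤ a) (hη : 0 ≤ η) (hs : 0 ≤ s)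
    (hX : AEMeasurable X μ) (hpos : ∀ᵐ ω ∂μ, 0 < X ω)
    (hlog : Integrable (fun ω => Real.log (X ω)) μ) :
    Integrable (fun ω => nearRate a η s (X ω)) μ := by
  have hc : 0 ≤ a * η⁻¹ * s := by positivity
  refine (((integrable_const (Real.log (1 + a * η⁻¹ * s))).add hlog.abs).div_const
    (Real.log 2)).mono' ((measurable_nearRate a η s).comp_aemeasurable hX).aestronglyMeasurable ?_
  filter_upwards [hpos] with ω hω
  rw [Real.norm_of_nonneg (nearRate_nonneg ha hη hs hω.le), nearRate, Real.logb]
  have := Real.log_pos one_lt_two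
  gcongr
  exact log_one_add_mul_le hc hω

lemma integrable_farRate {a a' η s : ℝ} (ha : 0 < a) (ha' : 0 ≤ a') (hη : 0 ≤ η) (hs : 0 ≤ s)
    (hX : AEMeasurable X μ) (hpos : ∀ᵐ ω ∂μ, 0 < X ω) :
    Integrable (fun ω => farRate a a' η s (X ω)) μ := by
  refine (integrable_const (Real.logb 2 (1 + a' / a))).mono'
    ((measurable_farRate a a' η s).comp_aemeasurable hX).aestronglyMeasurable ?_
  filter_upwards [hpos] with ω hω
  rw [Real.norm_of_nonneg (farRate_nonneg ha.le ha' hη hs hω.le)]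
  exact farRate_le ha ha' hη hs hω.le

lemma tendsto_integral_log_one_add_sub_log {c k : ℝ} {s : ℝ → ℝ} (hc : 0 < c) (hk : 0 < k)
    (hs : Tendsto (fun p => s p / p) atTop (𝓝 k))
    (hX : AEMeasurable X μ) (hpos : ∀ᵐ ω ∂μ, 0 < X ω)
    (hlog : Integrable (fun ω => Real.log (X ω)) μ) :
    Tendsto (fun p => ∫ ω, (Real.log (1 + c * s p * X ω) - Real.log p) ∂μ) atTop
      (𝓝 (Real.log (c * k) + ∫ ω, Real.log (X ω) ∂μ)) := by
  have hlim : ∫ ω, (Real.log (c * k) + Real.log (X ω)) ∂μ =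
      Real.log (c * k) + ∫ ω, Real.log (X ω) ∂μ := by
    rw [integral_add (integrable_const _) hlog]
    simp
  rw [← hlim]
  have hrw (p x : ℝ) (hp : 0 < p) (hs : 0 < s p / p) (hx : 0 < x) :
      Real.log (1 + c * s p * x) - Real.log p = Real.log (p⁻¹ + c * (s p / p) * x) := by
    have : 0 < s p := by have := mul_pos hs hp; rwa [div_mul_cancel₀ _ hp.ne'] at this
    rw [← Real.log_div (by positivity) hp.ne']
    congr 1
    field_simp
  -- Pinching s p / p between k/2 and 2k makes the dominating function independent of p.
  have hlow := hs.eventually_const_le (half_lt_self hk)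
  have hup := hs.eventually_le_const (show k < 2 * k by linarith)
  refine tendsto_integral_filter_of_dominated_convergence
    (fun ω => |Real.log (c * (k / 2))| + Real.log (1 + c * (2 * k)) + |Real.log (X ω)|)
    (Eventually.of_forall fun p => ?_) ?_ ((integrable_const _).add hlog.abs) ?_
  · exact AEMeasurable.aestronglyMeasurable (by fun_prop)
  · filter_upwards [hlow, hup, eventually_ge_atTop 1] with p h1 h2 hp
    filter_upwards [hpos] with ω hω
    have hsp : 0 < s p / p := (half_pos hk).trans_le h1
    have hp0 : 0 < p := one_pos.trans_le hp
    rw [hrw p _ hp0 hsp hω, Real.norm_eq_abs]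
    have hl : c * (k / 2) * X ω ≤ p⁻¹ + c * (s p / p) * X ω := by
      have : c * (k / 2) * X ω ≤ c * (s p / p) * X ω := by gcongr
      have : 0 < p⁻¹ := by positivity
      linarith
    have hu : p⁻¹ + c * (s p / p) * X ω ≤ 1 + c * (2 * k) * X ω := by
      have := inv_le_one_of_one_le₀ hp
      gcongr
    have hl' := Real.log_le_log (by positivity) hl
    rw [Real.log_mul (by positivity) hω.ne'] at hl'
    have hu' := (Real.log_le_log (by positivity) hu).trans
      (log_one_add_mul_le (by positivity) hω)
    have h3 := neg_abs_le (Real.log (c * (k / 2)))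
    have h4 := neg_abs_le (Real.log (X ω))
    have h5 : 0 ≤ Real.log (1 + c * (2 * k)) :=
      Real.log_nonneg (le_add_of_nonneg_right (by positivity))
    have h6 := abs_nonneg (Real.log (c * (k / 2)))
    exact abs_le.2 ⟨by linarith, by linarith⟩
  · filter_upwards [hpos] with ω hω
    rw [← Real.log_mul (by positivity) hω.ne']
    have h1 : Tendsto (fun p => Real.log (p⁻¹ + c * (s p / p) * X ω)) atTop
        (𝓝 (Real.log (c * k * X ω))) := by
      refine Tendsto.log ?_ (by positivity)
      simpa using tendsto_inv_atTop_zero.add ((hs.const_mul c).mul_const (X ω))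
    refine h1.congr' ?_
    filter_upwards [hlow, eventually_gt_atTop 0] with p h1 hp
    exact (hrw p _ hp ((half_pos hk).trans_le h1) hω).symm

lemma tendsto_integral_nearRate_sub_logb {a η k : ℝ} {s : ℝ → ℝ} (ha : 0 < a) (hη : 0 < η)
    (hk : 0 < k) (hs0 : ∀ p, 0 < p → 0 ≤ s p) (hs : Tendsto (fun p => s p / p) atTop (𝓝 k))
    (hX : AEMeasurable X μ) (hpos : ∀ᵐ ω ∂μ, 0 < X ω)
    (hlog : Integrable (fun ω => Real.log (X ω)) μ) :
    Tendsto (fun p => ∫ ω, nearRate a η (s p) (X ω) ∂μ - Real.logb 2 p) atTop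
      (𝓝 (Real.logb 2 (a * η⁻¹ * k) + ∫ ω, Real.logb 2 (X ω) ∂μ)) := by
  have h := (tendsto_integral_log_one_add_sub_log (c := a * η⁻¹) (by positivity) hk hs hX hpos
    hlog).div_const (Real.log 2)
  have hl : (Real.log (a * η⁻¹ * k) + ∫ ω, Real.log (X ω) ∂μ) / Real.log 2 =
      Real.logb 2 (a * η⁻¹ * k) + ∫ ω, Real.logb 2 (X ω) ∂μ := by
    simp_rw [Real.logb]
    rw [integral_div, add_div]
  rw [hl] at h
  refine h.congr' ?_
  filter_upwards [eventually_gt_atTop 0] with p hp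
  have hi := integrable_nearRate ha.le hη.le (hs0 p hp) hX hpos hlog
  rw [← integral_div]
  have hsub : ∫ ω, (nearRate a η (s p) (X ω) - Real.logb 2 p) ∂μ =
      ∫ ω, nearRate a η (s p) (X ω) ∂μ - Real.logb 2 p := by
    rw [integral_sub hi (integrable_const _)]
    simp
  rw [← hsub]
  congr 1
  ext ω
  rw [nearRate, Real.logb, Real.logb, sub_div]

lemma tendsto_integral_farRate {a a' η : ℝ} {s : ℝ → ℝ} (ha : 0 < a) (ha' : 0 ≤ a') (hη : 0 < η)
    (hs0 : ∀ p, 0 < p → 0 ≤ s p) (hs : Tendsto s atTop atTop)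
    (hX : AEMeasurable X μ) (hpos : ∀ᵐ ω ∂μ, 0 < X ω) :
    Tendsto (fun p => ∫ ω, farRate a a' η (s p) (X ω) ∂μ) atTop
      (𝓝 (Real.logb 2 (1 + a' / a))) := by
  have hlim : ∫ _ : Ω, Real.logb 2 (1 + a' / a) ∂μ = Real.logb 2 (1 + a' / a) := by simp
  rw [← hlim]
  refine tendsto_integral_filter_of_dominated_convergence
    (fun _ => Real.logb 2 (1 + a' / a)) (Eventually.of_forall fun p =>
      ((measurable_farRate a a' η (s p)).comp_aemeasurable hX).aestronglyMeasurable) ?_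
    (integrable_const _) ?_
  · filter_upwards [eventually_gt_atTop 0] with p hp
    filter_upwards [hpos] with ω hω
    rw [Real.norm_of_nonneg (farRate_nonneg ha.le ha' hη.le (hs0 p hp) hω.le)]
    exact farRate_le ha ha' hη.le (hs0 p hp) hω.le
  · filter_upwards [hpos] with ω hω
    -- The signal-to-interference ratio is divided through by η⁻¹ X s, leaving a noise term that
    -- vanishes.
    have h1 : Tendsto (fun p => Real.log (1 + a' / (a + (η⁻¹ * X ω * s p)⁻¹))) atTop
        (𝓝 (Real.log (1 + a' / (a + 0)))) := by
      have h2 : Tendsto (fun p => (η⁻¹ * X ω * s p)⁻¹) atTop (𝓝 0) :=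
        (hs.const_mul_atTop (by positivity)).inv_tendsto_atTop
      refine Tendsto.log ?_ (by positivity)
      exact (tendsto_const_nhds.div (h2.const_add a) (by simpa using ha.ne')).const_add 1
    rw [add_zero] at h1
    refine (h1.div_const (Real.log 2)).congr' ?_
    filter_upwards [hs.eventually_gt_atTop 0] with p hp
    rw [farRate, Real.logb]
    congr 3
    field_simp

end Asymptotics

/-- The high-SNR expansion of the rate of a user pair. -/
lemma tendsto_integral_pair_sub_logb {Ω Ω' : Type*} [MeasurableSpace Ω] [MeasurableSpace Ω']
    {μ : Measure Ω} [IsProbabilityMeasure μ] {μ' : Measure Ω'} [IsProbabilityMeasure μ']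
    {X : Ω → ℝ} {X' : Ω' → ℝ} {a a' η η' : ℝ} {M : ℕ} (hM : 0 < M) {s : ℝ → ℝ}
    (ha : 0 < a) (ha' : 0 < a') (haa' : a + a' = 1) (hη : 0 < η) (hη' : 0 < η')
    (hs0 : ∀ p, 0 < p → 0 ≤ s p) (hs : Tendsto (fun p => s p / p) atTop (𝓝 (M : ℝ)⁻¹))
    (hX : AEMeasurable X μ) (hpos : ∀ᵐ ω ∂μ, 0 < X ω)
    (hlog : Integrable (fun ω => Real.log (X ω)) μ)
    (hX' : AEMeasurable X' μ') (hpos' : ∀ᵐ ω ∂μ', 0 < X' ω) :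
    Tendsto (fun p => (∫ ω, nearRate a η (s p) (X ω) ∂μ +
        ∫ ω, farRate a a' η' (s p) (X' ω) ∂μ') - Real.logb 2 p) atTop
      (𝓝 (Real.logb 2 η⁻¹ - Real.logb 2 M + ∫ ω, Real.logb 2 (X ω) ∂μ)) := by
  have hM' : (0 : ℝ) < M := by exact_mod_cast hM
  have hst : Tendsto s atTop atTop := by
    refine (hs.pos_mul_atTop (by positivity) tendsto_id).congr' ?_
    filter_upwards [eventually_gt_atTop 0] with p hp
    rw [id, div_mul_cancel₀ _ hp.ne']
  have h := (tendsto_integral_nearRate_sub_logb ha hη (by positivity) hs0 hs hX hpos hlog).add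
    (tendsto_integral_farRate ha ha'.le hη' hs0 hst hX' hpos')
  have hlim : Real.logb 2 (a * η⁻¹ * (M : ℝ)⁻¹) + ∫ ω, Real.logb 2 (X ω) ∂μ +
      Real.logb 2 (1 + a' / a) =
      Real.logb 2 η⁻¹ - Real.logb 2 M + ∫ ω, Real.logb 2 (X ω) ∂μ := by
    -- The far user's limit is exactly -log₂ a, cancelling the near user's log₂ a.
    have : 1 + a' / a = a⁻¹ := by field_simp; exact haa'
    rw [this, Real.logb_mul (by positivity) (by positivity), Real.logb_mul (by positivity)
      (by positivity), Real.logb_inv _ (M : ℝ), Real.logb_inv _ a]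
    ring
  rw [hlim] at h
  refine h.congr fun p => ?_
  ring

lemma tendsto_div_logb_of_tendsto_sub {f : ℝ → ℝ} {A B : ℝ}
    (h : Tendsto (fun p => f p - (A * Real.logb 2 p + B)) atTop (𝓝 0)) :
    Tendsto (fun p => f p / Real.logb 2 p) atTop (𝓝 A) := by
  have hl : Tendsto (Real.logb 2) atTop atTop := Real.tendsto_logb_atTop one_lt_two
  have h1 := (((h.add_const B).div_atTop hl).add_const A)
  rw [zero_add] at h1
  refine h1.congr' ?_
  filter_upwards [hl.eventually_gt_atTop 0] with p hp
  field_simp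
  ring

/-! ### Water filling -/

lemma IsWaterFilling.nonneg {M L : ℕ} {lam : Fin M → ℝ} {p : ℝ} {s : Fin M → ℝ}
    (h : IsWaterFilling L lam p s) (m : Fin M) : 0 ≤ s m := by
  obtain ⟨ν, -, hs, -⟩ := h
  rw [hs]
  exact le_max_left _ _

/-- Water filling is uniform up to a bounded error. -/
lemma IsWaterFilling.abs_sub_le {M L : ℕ} (hM : 0 < M) {lam : Fin M → ℝ} {p : ℝ} {s : Fin M → ℝ}
    (h : IsWaterFilling L lam p s) (m : Fin M) :
    |s m - p / M| ≤ 2 * ∑ i, |1 / ((L : ℝ) * lam i)| := by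
  obtain ⟨ν, hν, hs, hp⟩ := h
  have hM' : (0 : ℝ) < M := by exact_mod_cast hM
  set B := ∑ i, |1 / ((L : ℝ) * lam i)|
  have hw : 0 < 1 / ν := by positivity
  -- Each power lies within B of the water level, hence so does their mean p/M; the triangle
  -- inequality gives the factor 2.
  have key (i : Fin M) : |s i - 1 / ν| ≤ B := by
    have h1 : |1 / ((L : ℝ) * lam i)| ≤ B :=
      Finset.single_le_sum (f := fun i => |1 / ((L : ℝ) * lam i)|) (fun _ _ => abs_nonneg _)
        (Finset.mem_univ i)
    have h2 := abs_le.1 h1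
    rw [hs i]
    refine abs_le.2 ⟨?_, ?_⟩
    · have := le_max_right 0 (1 / ν - 1 / ((L : ℝ) * lam i))
      linarith
    · have : max 0 (1 / ν - 1 / ((L : ℝ) * lam i)) ≤ 1 / ν + B := max_le (by linarith) (by linarith)
      linarith
  have hsum : |p / M - 1 / ν| ≤ B := by
    have h1 : p / M - 1 / ν = (∑ i, (s i - 1 / ν)) / M := by
      rw [Finset.sum_sub_distrib, hp]
      simp
      field_simp
    rw [h1, abs_div, abs_of_pos hM', div_le_iff₀ hM']
    calc _ ≤ ∑ i, |s i - 1 / ν| := Finset.abs_sum_le_sum_abs _ _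
      _ ≤ ∑ _i : Fin M, B := Finset.sum_le_sum fun i _ => key i
      _ = B * M := by simp [mul_comm]
  have h1 := abs_le.1 (key m)
  have h2 := abs_le.1 hsum
  exact abs_le.2 ⟨by linarith, by linarith⟩

lemma tendsto_waterFilling_div {M L : ℕ} (hM : 0 < M) {lam : Fin M → ℝ} {s : ℝ → Fin M → ℝ}
    (hs : ∀ p, 0 < p → IsWaterFilling L lam p (s p)) (m : Fin M) :
    Tendsto (fun p => s p m / p) atTop (𝓝 (M : ℝ)⁻¹) := by
  have hM' : (0 : ℝ) < M := by exact_mod_cast hM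
  have h0 : Tendsto (fun p : ℝ => (2 * ∑ i, |1 / ((L : ℝ) * lam i)|) / p) atTop (𝓝 0) :=
    tendsto_const_nhds.div_atTop tendsto_id
  rw [tendsto_iff_norm_sub_tendsto_zero]
  refine tendsto_of_tendsto_of_tendsto_of_le_of_le' tendsto_const_nhds h0
    (Eventually.of_forall fun _ => norm_nonneg _) ?_
  filter_upwards [eventually_gt_atTop 0] with p hp
  have h1 : s p m / p - (M : ℝ)⁻¹ = (s p m - p / M) / p := by field_simp
  rw [h1, Real.norm_eq_abs, abs_div, abs_of_pos hp]
  gcongr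
  exact (hs p hp).abs_sub_le hM m

/-! ### Optimality of the sensing-centric precoder -/

/-- Multiply x ≤ exp(x - 1) over the nonnegative eigenvalues; equality holds at B = 1. -/
lemma det_re_le_exp_trace_sub {n : Type*} [Fintype n] [DecidableEq n] {B : Matrix n n ℂ}
    (hB : B.PosSemidef) : B.det.re ≤ Real.exp (B.trace.re - Fintype.card n) := by
  have hd : B.det = ((∏ i, hB.1.eigenvalues i : ℝ) : ℂ) := by
    rw [hB.1.det_eq_prod_eigenvalues]; push_cast; rfl
  have ht : B.trace = ((∑ i, hB.1.eigenvalues i : ℝ) : ℂ) := by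
    rw [hB.1.trace_eq_sum_eigenvalues]; push_cast; rfl
  rw [hd, ht, Complex.ofReal_re, Complex.ofReal_re]
  have h1 : (∑ i, hB.1.eigenvalues i) - Fintype.card n = ∑ i, (hB.1.eigenvalues i - 1) := by
    rw [Finset.sum_sub_distrib]
    simp
  rw [h1, Real.exp_sum]
  refine Finset.prod_le_prod (fun i _ => hB.eigenvalues_nonneg i) fun i _ => ?_
  have := Real.add_one_le_exp (hB.1.eigenvalues i - 1)
  linarith

/-- Conjugating by diag(d)^(-1/2) moves the equality case to 1 + WWᴴ = diag(d), so d can be tuned to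
the candidate optimum. -/
lemma det_one_add_mul_conjTranspose_le {n : Type*} [Fintype n] [DecidableEq n]
    (W : Matrix n n ℂ) (d : n → ℝ) (hd : ∀ i, 0 < d i) :
    (1 + W * Wᴴ).det.re ≤ (∏ i, d i) *
      Real.exp (∑ i, ((1 + ∑ k, ‖W i k‖ ^ 2) / d i - 1)) := by
  set E : Matrix n n ℂ := diagonal fun i => (((√(d i))⁻¹ : ℝ) : ℂ) with hE
  have hEh : Eᴴ = E := by
    rw [hE, diagonal_conjTranspose]
    congr 1
    ext i
    simp
  have hee (i : n) : (((√(d i))⁻¹ : ℝ) : ℂ) * (((√(d i))⁻¹ : ℝ) : ℂ) = (((d i)⁻¹ : ℝ) : ℂ) := by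
    rw [← Complex.ofReal_mul, ← mul_inv, Real.mul_self_sqrt (hd i).le]
  have hB : (E * (1 + W * Wᴴ) * E).PosSemidef := by
    have := (PosSemidef.one.add (posSemidef_self_mul_conjTranspose W)).mul_mul_conjTranspose_same E
    rwa [hEh] at this
  have h := det_re_le_exp_trace_sub hB
  have hprod : 0 < ∏ i, d i := Finset.prod_pos fun i _ => hd i
  have hdet : (E * (1 + W * Wᴴ) * E).det = (((∏ i, d i)⁻¹ : ℝ) : ℂ) * (1 + W * Wᴴ).det := by
    rw [det_mul, det_mul, mul_right_comm, hE, det_diagonal, ← Finset.prod_mul_distrib]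
    simp_rw [hee]
    push_cast
    rw [Finset.prod_inv_distrib]
  have htr : (E * (1 + W * Wᴴ) * E).trace.re - Fintype.card n =
      ∑ i, ((1 + ∑ k, ‖W i k‖ ^ 2) / d i - 1) := by
    rw [Finset.sum_sub_distrib]
    congr 1
    · rw [Matrix.trace, Complex.re_sum]
      refine Finset.sum_congr rfl fun i _ => ?_
      have h1 : (E * (1 + W * Wᴴ) * E).diag i =
          (((1 + ∑ k, ‖W i k‖ ^ 2) / d i : ℝ) : ℂ) := by
        rw [diag_apply, hE, mul_diagonal, diagonal_mul, mul_right_comm, hee]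
        simp only [Matrix.add_apply, Matrix.one_apply_eq, Matrix.mul_apply, conjTranspose_apply]
        push_cast
        simp_rw [RCLike.star_def, Complex.mul_conj']
        ring
      rw [h1, Complex.ofReal_re]
    · simp
  rw [hdet, htr, Complex.re_ofReal_mul, inv_mul_le_iff₀ hprod] at h
  exact h

lemma isSensingCentric_precoder {M L : ℕ} (hL : 0 < L) {R U : Matrix (Fin M) (Fin M) ℂ}
    {lam : Fin M → ℝ} (hR : R.PosDef) (hU : U ∈ Matrix.unitaryGroup (Fin M) ℂ)
    (hED : R = U * Matrix.diagonal (fun m => ((lam m : ℝ) : ℂ)) * Uᴴ) {p : ℝ} {s : Fin M → ℝ}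
    (hs : IsWaterFilling L lam p s) : IsSensingCentric L R p (precoder U s) := by
  have hUU : Uᴴ * U = 1 := Matrix.mem_unitaryGroup_iff'.1 hU
  have hUU' : U * Uᴴ = 1 := Matrix.mem_unitaryGroup_iff.1 hU
  have hlam (m : Fin M) : 0 < lam m := by
    have h1 : R = U * Matrix.diagonal (fun m => ((lam m : ℝ) : ℂ)) * star U := hED
    have hu : IsUnit U := IsUnit.of_mul_eq_one _ hUU'
    rw [h1, hu.posDef_star_right_conjugate_iff, posDef_diagonal_iff] at hR
    exact_mod_cast hR m
  have hL' : (0 : ℝ) < L := by exact_mod_cast hL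
  have hLl (m : Fin M) : 0 < L * lam m := mul_pos hL' (hlam m)
  set D : Matrix (Fin M) (Fin M) ℂ := diagonal fun m => ((√(L * lam m) : ℝ) : ℂ) with hD
  have hDh : Dᴴ = D := by
    rw [hD, diagonal_conjTranspose]
    congr 1
    ext i
    simp
  have hDD : D * D = (L : ℂ) • diagonal (fun m => ((lam m : ℝ) : ℂ)) := by
    rw [hD, diagonal_mul_diagonal, ← diagonal_smul]
    congr 1
    ext m
    rw [← Complex.ofReal_mul, Real.mul_self_sqrt (hLl m).le]
    simp
  -- With W = D Uᴴ P, the rate depends on det(1 + WᴴW) = det(1 + WWᴴ), and the bound above needs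
  -- only the row norms of W, that is the power P spends on each eigendirection.
  have hW (P : Matrix (Fin M) (Fin M) ℂ) :
      (L : ℂ) • (Pᴴ * R * P) = (D * (Uᴴ * P))ᴴ * (D * (Uᴴ * P)) := by
    have : (D * (Uᴴ * P))ᴴ * (D * (Uᴴ * P)) = Pᴴ * (U * (D * D) * Uᴴ) * P := by
      simp only [conjTranspose_mul, conjTranspose_conjTranspose, hDh, Matrix.mul_assoc]
    rw [this, hDD, hED]
    simp only [Matrix.mul_smul, Matrix.smul_mul]
  have hWn (P : Matrix (Fin M) (Fin M) ℂ) (i : Fin M) :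
      ∑ k, ‖(D * (Uᴴ * P)) i k‖ ^ 2 = L * lam i * ∑ k, ‖(Uᴴ * P) i k‖ ^ 2 := by
    rw [Finset.mul_sum]
    refine Finset.sum_congr rfl fun k _ => ?_
    rw [hD, diagonal_mul, norm_mul, mul_pow, Complex.norm_real, Real.norm_eq_abs, sq_abs,
      Real.sq_sqrt (hLl i).le]
  have htr (P : Matrix (Fin M) (Fin M) ℂ) :
      (P * Pᴴ).trace.re = ∑ i, ∑ k, ‖(Uᴴ * P) i k‖ ^ 2 := by
    have h1 : (P * Pᴴ).trace = ((Uᴴ * P) * (Uᴴ * P)ᴴ).trace := by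
      rw [conjTranspose_mul, conjTranspose_conjTranspose, Matrix.mul_assoc,
        trace_mul_comm Uᴴ, Matrix.mul_assoc, Matrix.mul_assoc, hUU', Matrix.mul_one]
    rw [h1, Matrix.trace, Complex.re_sum]
    refine Finset.sum_congr rfl fun i _ => ?_
    have h2 : ((Uᴴ * P) * (Uᴴ * P)ᴴ).diag i = ((∑ k, ‖(Uᴴ * P) i k‖ ^ 2 : ℝ) : ℂ) := by
      rw [diag_apply, Matrix.mul_apply]
      push_cast
      refine Finset.sum_congr rfl fun k _ => ?_
      rw [conjTranspose_apply, RCLike.star_def, Complex.mul_conj']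
    rw [h2, Complex.ofReal_re]
  have hs0 (m : Fin M) : 0 ≤ s m := hs.nonneg m
  have hUP : Uᴴ * precoder U s = diagonal fun m => ((√(s m) : ℝ) : ℂ) := by
    rw [precoder, ← Matrix.mul_assoc, hUU, Matrix.one_mul]
  have hq (m : Fin M) : ∑ k, ‖(Uᴴ * precoder U s) m k‖ ^ 2 = s m := by
    rw [hUP, Finset.sum_eq_single m]
    · rw [diagonal_apply_eq, Complex.norm_real, Real.norm_eq_abs, sq_abs, Real.sq_sqrt (hs0 m)]
    · intro k _ hk
      rw [diagonal_apply_ne' _ hk]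
      simp
    · simp
  obtain ⟨ν, hν, hsν, hsum⟩ := hs
  refine ⟨by rw [htr]; simp_rw [hq]; exact hsum.le, fun P hP => ?_⟩
  set d : Fin M → ℝ := fun m => 1 + L * lam m * s m with hd
  have hdpos (m : Fin M) : 0 < d m := by
    have := mul_nonneg (hLl m).le (hs0 m)
    simp only [hd]; linarith
  have hopt : (1 + (L : ℂ) • ((precoder U s)ᴴ * R * precoder U s)).det.re = ∏ m, d m := by
    rw [hW, hUP, hD, diagonal_mul_diagonal, diagonal_conjTranspose, diagonal_mul_diagonal,
      ← diagonal_one, diagonal_add, det_diagonal]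
    have h1 (m : Fin M) : (1 : ℂ) + star (fun i : Fin M => ((√(L * lam i) : ℝ) : ℂ) *
        ((√(s i) : ℝ) : ℂ)) m * (((√(L * lam m) : ℝ) : ℂ) * ((√(s m) : ℝ) : ℂ)) =
        ((d m : ℝ) : ℂ) := by
      simp only [Pi.star_apply, star_mul', RCLike.star_def, Complex.conj_ofReal]
      rw [mul_mul_mul_comm, ← Complex.ofReal_mul, ← Complex.ofReal_mul,
        Real.mul_self_sqrt (hLl m).le, Real.mul_self_sqrt (hs0 m)]
      simp [hd]
    simp_rw [h1]
    rw [← Complex.ofReal_prod, Complex.ofReal_re]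
  have hpos : 0 < (1 + (L : ℂ) • (Pᴴ * R * P)).det.re := by
    rw [hW]
    have := (PosDef.one.add_posSemidef
      (posSemidef_conjTranspose_mul_self (D * (Uᴴ * P)))).det_pos
    exact (Complex.pos_iff.1 this).1
  have hle : (1 + (L : ℂ) • (Pᴴ * R * P)).det.re ≤ ∏ m, d m := by
    rw [hW, det_one_add_mul_comm]
    refine (det_one_add_mul_conjTranspose_le _ d hdpos).trans ?_
    refine mul_le_of_le_one_right (Finset.prod_nonneg fun m _ => (hdpos m).le) ?_
    rw [Real.exp_le_one_iff]
    simp_rw [hWn]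
    -- KKT with multiplier ν: the marginal gain Lλ/d equals ν on active modes and is at most ν where
    -- s = 0. The sum is then at most ν(tr PPᴴ - p) ≤ 0.
    have hterm (m : Fin M) : (1 + L * lam m * ∑ k, ‖(Uᴴ * P) m k‖ ^ 2) / d m - 1 ≤
        ν * (∑ k, ‖(Uᴴ * P) m k‖ ^ 2 - s m) := by
      have hq0 : 0 ≤ ∑ k, ‖(Uᴴ * P) m k‖ ^ 2 := by positivity
      set q := ∑ k, ‖(Uᴴ * P) m k‖ ^ 2
      have h1 : (1 + L * lam m * q) / d m - 1 = L * lam m / d m * (q - s m) := by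
        have := (hdpos m).ne'
        field_simp
        simp only [hd]
        ring
      rw [h1]
      rcases le_or_gt (1 / ν - 1 / (L * lam m)) 0 with h | h
      · have hsm : s m = 0 := by rw [hsν m, max_eq_left h]
        have hdm : d m = 1 := by simp [hd, hsm]
        rw [hsm, sub_zero, hdm, div_one]
        have h2 : 1 / ν ≤ 1 / (L * lam m) := by linarith
        have := (one_div_le_one_div hν (hLl m)).1 h2
        gcongr
      · have hsm : s m = 1 / ν - 1 / (L * lam m) := by rw [hsν m, max_eq_right h.le]
        have hdm : L * lam m / d m = ν := by
          have := (hlam m).ne'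
          rw [div_eq_iff (hdpos m).ne']
          simp only [hd, hsm]
          field_simp
          ring
        rw [hdm]
    refine (Finset.sum_le_sum fun m _ => hterm m).trans ?_
    rw [← Finset.mul_sum, Finset.sum_sub_distrib, hsum, ← htr]
    exact mul_nonpos_of_nonneg_of_nonpos hν.le (by linarith)
  unfold sensingRate
  rw [hopt]
  refine mul_le_mul_of_nonneg_left ?_ (by positivity)
  exact Real.logb_le_logb_of_le one_lt_two hpos hle

/-! ### Signal alignment -/

section Alignment

variable {Ω : Type*} [MeasurableSpace Ω] {μ : Measure Ω} {M N : ℕ}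

lemma hasLaw_largestEigenvalue {H : Ω → Fin N → Fin M → ℂ} (hH : HasLaw H (rayleighLaw N M) μ) :
    HasLaw (fun ω => largestEigenvalue (Matrix.of (H ω))) (largestEigenvalueLaw N M) μ :=
  HasLaw.fun_comp (Y := fun h : Fin N → Fin M → ℂ => largestEigenvalue (Matrix.of h))
    ⟨(measurable_largestEigenvalue N M).aemeasurable, rfl⟩ hH

lemma ae_inv_norm_sq_le_largestEigenvalue {U : Matrix (Fin M) (Fin M) ℂ}
    (hU : U ∈ Matrix.unitaryGroup (Fin M) ℂ) (m : Fin M) {H : Ω → Fin N → Fin M → ℂ}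
    {v : Ω → EuclideanSpace ℂ (Fin N)}
    (hv : ∀ᵐ ω ∂μ, (Matrix.of (H ω))ᴴ *ᵥ (v ω).ofLp = fun i => U i m) :
    ∀ᵐ ω ∂μ, 0 < (‖v ω‖ ^ 2)⁻¹ ∧ (‖v ω‖ ^ 2)⁻¹ ≤ largestEigenvalue (Matrix.of (H ω)) := by
  have hu : ∑ i, ‖U i m‖ ^ 2 = 1 := by
    have h := sum_norm_sq_mulVec hU (Pi.single m 1)
    have h1 : ∑ k, ‖(Pi.single m 1 : Fin M → ℂ) k‖ ^ 2 = 1 := by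
      rw [Finset.sum_eq_single m (fun k _ hk => by simp [hk]) (by simp)]
      simp
    rwa [mulVec_single_one, h1] at h
  filter_upwards [hv] with ω hω
  exact inv_norm_sq_le_largestEigenvalue _ (v ω) _ hu hω

/-- The comparison is made on Ω with the eigenvalue of the actual channel; only afterwards is its
expectation rewritten through its law. -/
lemma integrable_and_integral_le_of_le {f : ℝ → ℝ} (hf : Measurable f)
    (hf0 : ∀ x, 0 ≤ x → 0 ≤ f x) (hmono : ∀ x y, 0 ≤ x → x ≤ y → f x ≤ f y)
    {H : Ω → Fin N → Fin M → ℂ} (hH : HasLaw H (rayleighLaw N M) μ) {X : Ω → ℝ}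
    (hX : AEMeasurable X μ)
    (hle : ∀ᵐ ω ∂μ, 0 < X ω ∧ X ω ≤ largestEigenvalue (Matrix.of (H ω)))
    (hint : Integrable f (largestEigenvalueLaw N M)) :
    Integrable (fun ω => f (X ω)) μ ∧
      ∫ ω, f (X ω) ∂μ ≤ ∫ x, f x ∂(largestEigenvalueLaw N M) := by
  have hΛ := hasLaw_largestEigenvalue hH
  have hfΛ : Integrable (fun ω => f (largestEigenvalue (Matrix.of (H ω)))) μ := by
    refine (integrable_map_measure hf.aestronglyMeasurable hΛ.aemeasurable).1 ?_
    rwa [hΛ.map_eq]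
  have h1 : Integrable (fun ω => f (X ω)) μ := by
    refine hfΛ.mono' (hf.comp_aemeasurable hX).aestronglyMeasurable ?_
    filter_upwards [hle] with ω hω
    rw [Real.norm_of_nonneg (hf0 _ hω.1.le)]
    exact hmono _ _ hω.1.le hω.2
  refine ⟨h1, ?_⟩
  rw [← hΛ.map_eq, integral_map hΛ.aemeasurable hf.aestronglyMeasurable]
  refine integral_mono_ae h1 hfΛ ?_
  filter_upwards [hle] with ω hω
  exact hmono _ _ hω.1.le hω.2

end Alignment

/-! ### Summation over the pairs and the main theorem. -/

lemma tendsto_sum_pair_sub {M : ℕ} {E : ℝ} {η : Fin M → ℝ} {f : ℝ → Fin M → ℝ}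
    (h : ∀ m, Tendsto (fun p => f p m - Real.logb 2 p) atTop
      (𝓝 (Real.logb 2 (η m)⁻¹ - Real.logb 2 M + E))) :
    Tendsto (fun p => ∑ m, f p m - ((M : ℝ) * (Real.logb 2 p - Real.logb 2 M + E) +
      ∑ m, Real.logb 2 (η m)⁻¹)) atTop (𝓝 0) ∧
    Tendsto (fun p => (∑ m, f p m) / Real.logb 2 p) atTop (𝓝 (M : ℝ)) := by
  have h1 : Tendsto (fun p => ∑ m, f p m - ((M : ℝ) * (Real.logb 2 p - Real.logb 2 M + E) +
      ∑ m, Real.logb 2 (η m)⁻¹)) atTop (𝓝 0) := by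
    have h2 := (tendsto_finsetSum Finset.univ fun m _ => h m).sub_const
      (∑ m, (Real.logb 2 (η m)⁻¹ - Real.logb 2 M + E))
    rw [sub_self] at h2
    refine h2.congr fun p => ?_
    simp only [Finset.sum_sub_distrib, Finset.sum_add_distrib, Finset.sum_const,
      Finset.card_univ, Fintype.card_fin, nsmul_eq_mul]
    ring
  refine ⟨h1, tendsto_div_logb_of_tendsto_sub
    (B := (M : ℝ) * (E - Real.logb 2 M) + ∑ m, Real.logb 2 (η m)⁻¹) (h1.congr fun p => ?_)⟩
  ring

end NomaIsac

theorem mainTheorem12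
    (M N L : ℕ) (hM : 0 < M) (hMN : M ≤ N) (hL : 0 < L)
    -- the correlation matrix `R` of the target response, with an eigendecomposition
    (R U : Matrix (Fin M) (Fin M) ℂ) (lam : Fin M → ℝ)
    (hR : R.PosDef) (hU : U ∈ Matrix.unitaryGroup (Fin M) ℂ)
    (hED : R = U * Matrix.diagonal (fun m => ((lam m : ℝ) : ℂ)) * Uᴴ)
    -- power coefficients and path losses of the near users and of the far users
    (a a' η η' : Fin M → ℝ)
    (ha : ∀ m, 0 < a m) (ha' : ∀ m, 0 < a' m) (haa' : ∀ m, a m + a' m = 1)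
    (hη : ∀ m, 0 < η m) (hη' : ∀ m, 0 < η' m)
    -- the Rayleigh fading channels of the near users and of the far users
    {Ω : Type*} [MeasurableSpace Ω] (μ : Measure Ω) [IsProbabilityMeasure μ]
    (H H' : Fin M → Ω → Fin N → Fin M → ℂ)
    (hH : ∀ m, HasLaw (H m) (NomaIsac.rayleighLaw N M) μ)
    (hH' : ∀ m, HasLaw (H' m) (NomaIsac.rayleighLaw N M) μ)
    -- the detection vectors: arbitrary solutions of the signal alignment equations
    (v v' : Fin M → Ω → EuclideanSpace ℂ (Fin N))
    (hv_meas : ∀ m, AEMeasurable (v m) μ) (hv'_meas : ∀ m, AEMeasurable (v' m) μ)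
    (hv : ∀ m, ∀ᵐ ω ∂μ, (Matrix.of (H m ω))ᴴ *ᵥ (v m ω).ofLp = fun i => U i m)
    (hv' : ∀ m, ∀ᵐ ω ∂μ, (Matrix.of (H' m ω))ᴴ *ᵥ (v' m ω).ofLp = fun i => U i m)
    -- the power allocation of the sensing-centric design, for every power budget `p`
    (s : ℝ → Fin M → ℝ) (hs : ∀ p, 0 < p → NomaIsac.IsWaterFilling L lam p (s p)) :
    -- the precoder is sensing-centric
    (∀ p, 0 < p → NomaIsac.IsSensingCentric L R p (NomaIsac.precoder U (s p))) ∧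
    -- all expectations involved exist
    Integrable (fun x => Real.logb 2 x) (NomaIsac.largestEigenvalueLaw N M) ∧
    (∀ p, 0 < p → ∀ m,
      Integrable (NomaIsac.nearRate (a m) (η m) (s p m)) (NomaIsac.largestEigenvalueLaw N M) ∧
      Integrable (NomaIsac.farRate (a m) (a' m) (η' m) (s p m))
        (NomaIsac.largestEigenvalueLaw N M) ∧
      Integrable (fun ω => NomaIsac.nearRate (a m) (η m) (s p m) (‖v m ω‖ ^ 2)⁻¹) μ ∧
      Integrable (fun ω => NomaIsac.farRate (a m) (a' m) (η' m) (s p m) (‖v' m ω‖ ^ 2)⁻¹) μ) ∧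
    -- the upper bound of the sum ECR
    (∀ p, 0 < p → NomaIsac.sumECR μ a a' η η' (s p) v v' ≤
      NomaIsac.sumECRBound N a a' η η' (s p)) ∧
    -- its asymptotics and its high-SNR slope
    Tendsto (fun p : ℝ => NomaIsac.sumECRBound N a a' η η' (s p) -
      ((M : ℝ) * (Real.logb 2 p - Real.logb 2 M +
          ∫ x, Real.logb 2 x ∂(NomaIsac.largestEigenvalueLaw N M)) +
        ∑ m, Real.logb 2 (η m)⁻¹)) atTop (𝓝 0) ∧
    Tendsto (fun p : ℝ => NomaIsac.sumECRBound N a a' η η' (s p) / Real.logb 2 p)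
      atTop (𝓝 (M : ℝ)) ∧
    -- the asymptotics and the high-SNR slope of the exact sum ECR for `N = M`
    (N = M →
      Tendsto (fun p : ℝ => NomaIsac.sumECR μ a a' η η' (s p) v v' -
        ((M : ℝ) * (Real.logb 2 p - Real.logb 2 M -
            Real.eulerMascheroniConstant / Real.log 2) +
          ∑ m, Real.logb 2 (η m)⁻¹)) atTop (𝓝 0) ∧
      Tendsto (fun p : ℝ => NomaIsac.sumECR μ a a' η η' (s p) v v' / Real.logb 2 p)
        atTop (𝓝 (M : ℝ))) := by
  have hN : 0 < N := hM.trans_le hMN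
  have hs0 (m : Fin M) (p : ℝ) (hp : 0 < p) : 0 ≤ s p m := (hs p hp).nonneg m
  have hslim := NomaIsac.tendsto_waterFilling_div hM hs
  have hΛpos := NomaIsac.ae_pos_largestEigenvalueLaw (N := N) (M := M) hN hM
  have hΛlog := NomaIsac.integrable_log_largestEigenvalueLaw (N := N) (M := M) hN hM
  have hvle (m : Fin M) := NomaIsac.ae_inv_norm_sq_le_largestEigenvalue hU m (hv m)
  have hvle' (m : Fin M) := NomaIsac.ae_inv_norm_sq_le_largestEigenvalue hU m (hv' m)
  have hX (m : Fin M) : AEMeasurable (fun ω => (‖v m ω‖ ^ 2)⁻¹) μ :=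
    ((hv_meas m).norm.pow_const 2).inv
  have hX' (m : Fin M) : AEMeasurable (fun ω => (‖v' m ω‖ ^ 2)⁻¹) μ :=
    ((hv'_meas m).norm.pow_const 2).inv
  have hnearΛ (p : ℝ) (hp : 0 < p) (m : Fin M) :
      Integrable (NomaIsac.nearRate (a m) (η m) (s p m)) (NomaIsac.largestEigenvalueLaw N M) :=
    NomaIsac.integrable_nearRate (X := fun x => x) (ha m).le (hη m).le (hs0 m p hp)
      aemeasurable_id hΛpos hΛlog
  have hfarΛ (p : ℝ) (hp : 0 < p) (m : Fin M) :
      Integrable (NomaIsac.farRate (a m) (a' m) (η' m) (s p m))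
        (NomaIsac.largestEigenvalueLaw N M) :=
    NomaIsac.integrable_farRate (X := fun x => x) (ha m) (ha' m).le (hη' m).le (hs0 m p hp)
      aemeasurable_id hΛpos
  have hnear (p : ℝ) (hp : 0 < p) (m : Fin M) :=
    NomaIsac.integrable_and_integral_le_of_le
      (NomaIsac.measurable_nearRate (a m) (η m) (s p m))
      (fun _ hx => NomaIsac.nearRate_nonneg (ha m).le (hη m).le (hs0 m p hp) hx)
      (fun _ _ hx hxy => NomaIsac.nearRate_mono (ha m).le (hη m).le (hs0 m p hp) hx hxy)
      (hH m) (hX m) (hvle m) (hnearΛ p hp m)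
  have hfar (p : ℝ) (hp : 0 < p) (m : Fin M) :=
    NomaIsac.integrable_and_integral_le_of_le
      (NomaIsac.measurable_farRate (a m) (a' m) (η' m) (s p m))
      (fun _ hx => NomaIsac.farRate_nonneg (ha m).le (ha' m).le (hη' m).le (hs0 m p hp) hx)
      (fun _ _ hx hxy =>
        NomaIsac.farRate_mono (ha m).le (ha' m).le (hη' m).le (hs0 m p hp) hx hxy)
      (hH' m) (hX' m) (hvle' m) (hfarΛ p hp m)
  have hbound := NomaIsac.tendsto_sum_pair_sub fun m =>
    NomaIsac.tendsto_integral_pair_sub_logb (μ := NomaIsac.largestEigenvalueLaw N M)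
      (μ' := NomaIsac.largestEigenvalueLaw N M) (X := fun x => x) (X' := fun x => x)
      hM (ha m) (ha' m) (haa' m) (hη m) (hη' m)
      (hs0 m) (hslim m) aemeasurable_id hΛpos hΛlog aemeasurable_id hΛpos
  refine ⟨fun p hp => NomaIsac.isSensingCentric_precoder hL hR hU hED (hs p hp),
    hΛlog.div_const _, fun p hp m => ⟨hnearΛ p hp m, hfarΛ p hp m, (hnear p hp m).1,
      (hfar p hp m).1⟩, fun p hp => ?_, hbound.1, hbound.2, ?_⟩
  · exact Finset.sum_le_sum fun m _ => add_le_add (hnear p hp m).2 (hfar p hp m).2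
  · rintro rfl
    -- Only the near gains need their exact law; for the far gains positivity and measurability
    -- suffice.
    have hlaw (m : Fin N) := NomaIsac.integrable_log_and_integral_log_of_hasLaw
      (NomaIsac.hasLaw_inv_norm_sq hU m (hH m) (hv m))
    have hmean (m : Fin N) : ∫ ω, Real.logb 2 (‖v m ω‖ ^ 2)⁻¹ ∂μ =
        -(Real.eulerMascheroniConstant / Real.log 2) := by
      simp_rw [Real.logb]
      rw [integral_div, (hlaw m).2, neg_div]
    have hexact := NomaIsac.tendsto_sum_pair_sub
      (E := -(Real.eulerMascheroniConstant / Real.log 2)) (η := η) fun m => by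
        have h := NomaIsac.tendsto_integral_pair_sub_logb (μ := μ) (μ' := μ)
          (X := fun ω => (‖v m ω‖ ^ 2)⁻¹) (X' := fun ω => (‖v' m ω‖ ^ 2)⁻¹)
          hM (ha m) (ha' m) (haa' m) (hη m) (hη' m) (hs0 m) (hslim m) (hX m)
          ((hvle m).mono fun _ h => h.1) (hlaw m).1 (hX' m) ((hvle' m).mono fun _ h => h.1)
        rw [hmean m] at h
        exact h
    simp only [← sub_eq_add_neg] at hexact
    exact hexact
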